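/- For $d\ge 1$ let $\mathcal L_d$ be the Ehrhart polynomial of the $d$-dimensional cross-polytope $\mathcal P_d=\operatorname{conv}\{\pm e_1,\dots,\pm e_d\}\subset\mathbb R^d$, i.e. the polynomial with $\mathcal L_d(m)=\#(\mathbb Z^d\cap m\mathcal P_d)$ for all integers $m\ge 0$; explicitly $$\mathcal L_d(x)=\sum_{j=0}^d\binom dj\binom{d-j+x}{d}.$$ For real $a<b$ let $N_d(a,b)$ be the number of complex roots of $\mathcal L_d$ whose imaginary part lies in $[a,b]$, and let $\varphi_d(\tau)=\arg\{(2d+1)^{-1/2-i\tau}\Gamma(1/2+i\tau)\}$ for $\tau\in\mathbb R$, where $\arg$ denotes the branch that is continuous in $\tau$ and vanishes at $\tau=0$ (where the function is positive). Put $$E_d(a,b)=N_d(a,b)-\frac{\varphi_d(a)-\varphi_d(b)}{\pi}.$$ (1) For every $\delta>0$ there is $D=D(\delta)$ such that for all $d\ge D$ and all $a,b$ with $-\log d\le a<b\le\log d$ one has $|E_d(a,b)|<1+\delta$; moreover $|E_d(a,b)|<1$ whenever at least one of the endpoints $a,b$ has distance at least $\delta/\log d$ from the imaginary part of every root of $\mathcal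 L_d$. (2) If $a_d<b_d$ are real numbers with $-\log d\le a_d<b_d\le\log d$ for all large $d$, and $(b_d-a_d)\log d\to\infty$ (for example, if $a_d=a$ and $b_d=b$ do not depend on $d$), then $$N_d(a_d,b_d)\sim\frac{\log d}{\pi}(b_d-a_d)\qquad(d\to\infty).$$ -/

import Mathlib

open Filter Topology Asymptotics

/-- The `d`-dimensional cross-polytope: the convex hull in `ℝ^d` of `± e_j`, `j = 1, …, d`. -/
def crossPolytope (d : ℕ) : Set (Fin d → ℝ) :=
  convexHull ℝ {v | ∃ j : Fin d, v = Pi.single j 1 ∨ v = -Pi.single j 1}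

/-- The number of integer points in the `m`-th dilate of the cross-polytope. -/
noncomputable def crossLatticeCount (d m : ℕ) : ℕ :=
  Set.ncard {v : Fin d → ℤ | ∃ w ∈ crossPolytope d, (fun i => (v i : ℝ)) = (m : ℝ) • w}

/-- The polynomial `binom(X + k, d) = (X + k)(X + k - 1)⋯(X + k - d + 1) / d!`. -/
noncomputable def shiftedBinomial (d k : ℕ) : Polynomial ℂ :=
  Polynomial.C ((d.factorial : ℂ)⁻¹) *
    (descPochhammer ℂ d).comp (Polynomial.X + Polynomial.C (k : ℂ))

/-- The Ehrhart polynomial of the `d`-dimensional cross-polytope,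
`∑_{j = 0}^{d} binom(d, j) binom(d - j + X, d)`; it is the polynomial that counts the lattice
points of the dilates, as `crossEhrhart_eval_natCast` shows. -/
noncomputable def crossEhrhart (d : ℕ) : Polynomial ℂ :=
  ∑ j ∈ Finset.range (d + 1), Polynomial.C (d.choose j : ℂ) * shiftedBinomial d (d - j)

/-- Delannoy-type numbers, the values of the Ehrhart polynomial at the natural numbers. -/
def crossNumber (d m : ℕ) : ℕ :=
  ∑ j ∈ Finset.range (d + 1), d.choose j * (d - j + m).choose d

theorem crossEhrhart_eval_crossNumber (d m : ℕ) :
    (crossEhrhart d).eval (m : ℂ) = crossNumber d m := by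
  unfold crossEhrhart shiftedBinomial crossNumber
  rw [Polynomial.eval_finsetSum]
  push_cast
  refine Finset.sum_congr rfl fun j _ => ?_
  simp only [Polynomial.eval_mul, Polynomial.eval_C, Polynomial.eval_comp, Polynomial.eval_add,
    Polynomial.eval_X]
  rw [show (m : ℂ) + ((d - j : ℕ) : ℂ) = ((d - j + m : ℕ) : ℂ) by push_cast; ring,
    descPochhammer_eval_eq_descFactorial, Nat.descFactorial_eq_factorial_mul_choose]
  have hf : (d.factorial : ℂ) ≠ 0 := by exact_mod_cast d.factorial_ne_zero
  push_cast
  rw [inv_mul_cancel_left₀ hf]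

theorem crossNumber_coeff (d m : ℕ) :
    (crossNumber d m : ℤ) =
      PowerSeries.coeff m ((1 + PowerSeries.X : PowerSeries ℤ) ^ d *
        PowerSeries.mk (fun n => ((d + n).choose d : ℤ))) := by
  unfold crossNumber
  rw [add_comm (1 : PowerSeries ℤ), add_pow, Finset.sum_mul, map_sum]
  push_cast
  refine Finset.sum_congr rfl fun j hj => ?_
  have hj' : j ≤ d := by simpa [Nat.lt_succ_iff] using hj
  rw [one_pow, mul_one, mul_assoc, PowerSeries.coeff_X_pow_mul',
    show ((d.choose j : ℕ) : PowerSeries ℤ) = PowerSeries.C (d.choose j : ℤ) by simp,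
    PowerSeries.coeff_C_mul, PowerSeries.coeff_mk]
  split_ifs with h
  · rw [show d - j + m = d + (m - j) by omega]
  · rw [Nat.choose_eq_zero_of_lt (by omega : d - j + m < d)]
    simp

theorem crossNumber_succ_succ (d m : ℕ) :
    crossNumber (d + 1) (m + 1) =
      crossNumber (d + 1) m + crossNumber d (m + 1) + crossNumber d m := by
  have hG : ∀ k : ℕ, (PowerSeries.mk (fun n => ((k + n).choose k : ℤ))) =
      (PowerSeries.mk 1 : PowerSeries ℤ) ^ (k + 1) := fun k =>
    (PowerSeries.mk_one_pow_eq_mk_choose_add ℤ k).symm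
  have h1 : (PowerSeries.mk 1 : PowerSeries ℤ) * (1 - PowerSeries.X) = 1 :=
    PowerSeries.mk_one_mul_one_sub_eq_one ℤ
  set Q : ℕ → PowerSeries ℤ := fun k =>
    (1 + PowerSeries.X) ^ k * (PowerSeries.mk 1 : PowerSeries ℤ) ^ (k + 1) with hQ
  have hc : ∀ k n, (crossNumber k n : ℤ) = PowerSeries.coeff n (Q k) := by
    intro k n
    rw [crossNumber_coeff, hG]
  have hrec : Q (d + 1) = Q (d + 1) * PowerSeries.X + Q d + Q d * PowerSeries.X := by
    have : Q (d + 1) * (1 - PowerSeries.X) = Q d * (1 + PowerSeries.X) := by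
      simp only [hQ]
      linear_combination (1 + PowerSeries.X) ^ (d + 1) *
        (PowerSeries.mk 1 : PowerSeries ℤ) ^ (d + 1) * h1
    linear_combination this
  have := congrArg (PowerSeries.coeff (m + 1)) hrec
  simp only [map_add, PowerSeries.coeff_succ_mul_X, ← hc] at this
  exact_mod_cast this

/-- Integer points of the `ℓ¹`-ball of radius `m`. -/
noncomputable def l1Points (d m : ℕ) : Finset (Fin d → ℤ) :=
  (Fintype.piFinset fun _ => Finset.Icc (-(m : ℤ)) m).filter fun v => ∑ i, (v i).natAbs ≤ m

theorem mem_l1Points {d m : ℕ} {v : Fin d → ℤ} :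
    v ∈ l1Points d m ↔ ∑ i, (v i).natAbs ≤ m := by
  unfold l1Points
  rw [Finset.mem_filter, Fintype.mem_piFinset]
  refine ⟨fun h => h.2, fun h => ⟨fun i => ?_, h⟩⟩
  have := Finset.single_le_sum (f := fun i => (v i).natAbs) (fun _ _ => Nat.zero_le _)
    (Finset.mem_univ i)
  simp only [Finset.mem_Icc]
  omega

theorem card_l1Points_succ_succ (d m : ℕ) :
    (l1Points (d + 1) (m + 1)).card =
      (l1Points (d + 1) m).card + (l1Points d (m + 1)).card + (l1Points d m).card := by
  have hz : ∀ n, ((l1Points (d + 1) n).filter fun v => v 0 = 0).card = (l1Points d n).card := by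
    intro n
    refine Finset.card_nbij' (fun v => Fin.tail v) (fun v => Fin.cons 0 v) ?_ ?_ ?_ ?_
    · intro v hv
      simp only [Finset.coe_filter, mem_l1Points, Set.mem_ofPred_eq, Fin.sum_univ_succ,
        Finset.mem_coe, Fin.tail] at hv ⊢
      omega
    · intro v hv
      simpa [mem_l1Points, Fin.sum_univ_succ] using hv
    · intro v hv
      simp only [Finset.coe_filter, Set.mem_ofPred_eq] at hv
      simp only
      rw [← hv.2, Fin.cons_self_tail]
    · intro v hv
      simp
  have hp : ((l1Points (d + 1) (m + 1)).filter fun v => 0 < v 0).card =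
      ((l1Points (d + 1) m).filter fun v => 0 ≤ v 0).card := by
    refine Finset.card_nbij' (fun v => Fin.cons (v 0 - 1) (Fin.tail v))
      (fun v => Fin.cons (v 0 + 1) (Fin.tail v)) ?_ ?_ ?_ ?_
    · intro v hv
      simp only [Finset.coe_filter, mem_l1Points, Set.mem_ofPred_eq, Fin.sum_univ_succ,
        Fin.cons_zero, Fin.cons_succ, Fin.tail] at hv ⊢
      omega
    · intro v hv
      simp only [Finset.coe_filter, mem_l1Points, Set.mem_ofPred_eq, Fin.sum_univ_succ,
        Fin.cons_zero, Fin.cons_succ, Fin.tail] at hv ⊢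
      omega
    · intro v hv
      simp
    · intro v hv
      simp
  have hn : ((l1Points (d + 1) (m + 1)).filter fun v => v 0 < 0).card =
      ((l1Points (d + 1) m).filter fun v => v 0 ≤ 0).card := by
    refine Finset.card_nbij' (fun v => Fin.cons (v 0 + 1) (Fin.tail v))
      (fun v => Fin.cons (v 0 - 1) (Fin.tail v)) ?_ ?_ ?_ ?_
    · intro v hv
      simp only [Finset.coe_filter, mem_l1Points, Set.mem_ofPred_eq, Fin.sum_univ_succ,
        Fin.cons_zero, Fin.cons_succ, Fin.tail] at hv ⊢
      omega
    · intro v hv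
      simp only [Finset.coe_filter, mem_l1Points, Set.mem_ofPred_eq, Fin.sum_univ_succ,
        Fin.cons_zero, Fin.cons_succ, Fin.tail] at hv ⊢
      omega
    · intro v hv
      simp
    · intro v hv
      simp
  have key : ∀ s : Finset (Fin (d + 1) → ℤ), s.card = (s.filter fun v => v 0 = 0).card +
      (s.filter fun v => 0 < v 0).card + (s.filter fun v => v 0 < 0).card ∧
      s.card + (s.filter fun v => v 0 = 0).card = (s.filter fun v => 0 ≤ v 0).card +
      (s.filter fun v => v 0 ≤ 0).card := by
    intro s
    rw [Finset.card_eq_sum_ones s]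
    simp only [Finset.card_filter, ← Finset.sum_add_distrib]
    constructor <;> refine Finset.sum_congr rfl fun v _ => ?_ <;>
      rcases lt_trichotomy (v 0) 0 with h | h | h <;> grind
  have h1 := (key (l1Points (d + 1) (m + 1))).1
  have h2 := (key (l1Points (d + 1) m)).2
  rw [hz, hp, hn] at h1
  rw [hz] at h2
  omega

theorem card_l1Points (d m : ℕ) : (l1Points d m).card = crossNumber d m := by
  induction d generalizing m with
  | zero => simp [l1Points, crossNumber]
  | succ d ihd =>
    induction m with
    | zero =>
      have h1 : l1Points (d + 1) 0 = {0} := by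
        ext v
        simp [mem_l1Points, funext_iff]
      rw [h1, Finset.card_singleton, crossNumber, Finset.sum_range_succ', Finset.sum_eq_zero]
      · simp
      · intro j _
        rw [Nat.choose_eq_zero_of_lt (by omega : d + 1 - (j + 1) + 0 < d + 1), mul_zero]
    | succ m ihm =>
      rw [card_l1Points_succ_succ, crossNumber_succ_succ, ihd, ihd, ihm]

theorem mem_crossPolytope {d : ℕ} (hd : 0 < d) (w : Fin d → ℝ) :
    w ∈ crossPolytope d ↔ ∑ i, |w i| ≤ 1 := by
  constructor
  · intro hw
    have hconv : Convex ℝ {v : Fin d → ℝ | ∑ i, |v i| ≤ 1} := by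
      intro x hx y hy a b ha hb hab
      simp only [Set.mem_ofPred_eq] at hx hy ⊢
      calc ∑ i, |(a • x + b • y) i| ≤ ∑ i, (a * |x i| + b * |y i|) := by
            refine Finset.sum_le_sum fun i _ => ?_
            simp only [Pi.add_apply, Pi.smul_apply, smul_eq_mul]
            refine (abs_add_le _ _).trans ?_
            rw [abs_mul, abs_mul, abs_of_nonneg ha, abs_of_nonneg hb]
        _ = a * ∑ i, |x i| + b * ∑ i, |y i| := by
            rw [Finset.sum_add_distrib, Finset.mul_sum, Finset.mul_sum]
        _ ≤ 1 := by nlinarith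
    refine convexHull_min ?_ hconv hw
    rintro v ⟨j, rfl | rfl⟩ <;>
      simp [Pi.single_apply, apply_ite abs]
  · intro hw
    have hc : Convex ℝ (crossPolytope d) := convex_convexHull ℝ _
    have hp : ∀ j, (Pi.single j 1 : Fin d → ℝ) ∈ crossPolytope d := fun j =>
      subset_convexHull ℝ _ ⟨j, Or.inl rfl⟩
    have hn : ∀ j, -(Pi.single j 1 : Fin d → ℝ) ∈ crossPolytope d := fun j =>
      subset_convexHull ℝ _ ⟨j, Or.inr rfl⟩
    have h0 : (0 : Fin d → ℝ) ∈ crossPolytope d := by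
      have := hc (hp ⟨0, hd⟩) (hn ⟨0, hd⟩) (by norm_num : (0 : ℝ) ≤ 1 / 2)
        (by norm_num : (0 : ℝ) ≤ 1 / 2) (by norm_num)
      simpa using this
    have hs : ∀ j, (SignType.sign (w j) : ℝ) • (Pi.single j 1 : Fin d → ℝ) ∈
        crossPolytope d := by
      intro j
      rcases lt_trichotomy (w j) 0 with h | h | h
      · simpa [sign_neg h] using hn j
      · simpa [h] using h0
      · simpa [sign_pos h] using hp j
    rcases eq_or_ne (∑ i, |w i|) 0 with hS | hS
    · have : w = 0 := by
        ext i
        have := (Finset.sum_eq_zero_iff_of_nonneg fun i _ => abs_nonneg (w i)).1 hS i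
          (Finset.mem_univ i)
        simpa using this
      rwa [this]
    · have hSp : 0 < ∑ i, |w i| :=
        lt_of_le_of_ne (Finset.sum_nonneg fun i _ => abs_nonneg _) hS.symm
      have hm := hc.sum_mem (t := Finset.univ) (w := fun i => |w i| / ∑ i, |w i|)
        (z := fun j => (SignType.sign (w j) : ℝ) • (Pi.single j 1 : Fin d → ℝ))
        (fun i _ => by positivity) (by rw [← Finset.sum_div, div_self hS]) fun i _ => hs i
      have := hc.starConvex h0 hm (by linarith : 0 ≤ 1 - ∑ i, |w i|) hSp.le (by ring)
      convert this using 1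
      ext k
      simp only [smul_zero, zero_add, Pi.smul_apply, Finset.sum_apply, smul_eq_mul,
        Pi.single_apply, mul_ite, mul_one, mul_zero, Finset.sum_ite_eq, Finset.mem_univ, if_true]
      rw [div_mul_eq_mul_div, mul_div_cancel₀ _ hS, abs_mul_sign]

theorem crossLatticeCount_eq {d : ℕ} (hd : 0 < d) (m : ℕ) :
    crossLatticeCount d m = (l1Points d m).card := by
  rw [crossLatticeCount, ← Set.ncard_coe_finset]
  congr 1
  ext v
  simp only [Set.mem_ofPred_eq, Finset.mem_coe, mem_l1Points]
  have hcast : ((∑ i, (v i).natAbs : ℕ) : ℝ) = ∑ i, |(v i : ℝ)| := by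
    push_cast [Nat.cast_natAbs]
    rfl
  constructor
  · rintro ⟨w, hw, hvw⟩
    rw [mem_crossPolytope hd] at hw
    have h : ∀ i, (v i : ℝ) = m * w i := fun i => congrFun hvw i
    have : ((∑ i, (v i).natAbs : ℕ) : ℝ) ≤ m := by
      rw [hcast]
      simp only [h, abs_mul, Nat.abs_cast, ← Finset.mul_sum]
      nlinarith [(Nat.cast_nonneg m : (0 : ℝ) ≤ m)]
    exact_mod_cast this
  · intro h
    have h' : ∑ i, |(v i : ℝ)| ≤ m := by
      rw [← hcast]
      exact_mod_cast h
    refine ⟨fun i => (v i : ℝ) / m, ?_, ?_⟩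
    · rw [mem_crossPolytope hd]
      simp only [abs_div, Nat.abs_cast, ← Finset.sum_div]
      exact div_le_one_of_le₀ h' (Nat.cast_nonneg m)
    · ext i
      simp only [Pi.smul_apply, smul_eq_mul]
      rcases Nat.eq_zero_or_pos m with rfl | hm
      · have := (Finset.sum_eq_zero_iff.1 (Nat.le_zero.1 h)) i (Finset.mem_univ i)
        simp [Int.natAbs_eq_zero.1 this]
      · have : (m : ℝ) ≠ 0 := by positivity
        field_simp

theorem crossEhrhart_eval_natCast {d : ℕ} (hd : 0 < d) (m : ℕ) :
    (crossEhrhart d).eval (m : ℂ) = crossLatticeCount d m := by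
  rw [crossEhrhart_eval_crossNumber, crossLatticeCount_eq hd, card_l1Points]

/-- The curve `τ ↦ (2d + 1)^{-1/2 - iτ} Γ(1/2 + iτ)`. -/
noncomputable def gammaCurve (d : ℕ) (τ : ℝ) : ℂ :=
  (2 * (d : ℂ) + 1) ^ (-(1 / 2 : ℂ) - Complex.I * τ) * Complex.Gamma (1 / 2 + Complex.I * τ)

theorem existsUnique_gammaArg (d : ℕ) :
    ∃! φ : ℝ → ℝ, Continuous φ ∧ φ 0 = 0 ∧
      ∀ τ, gammaCurve d τ = ‖gammaCurve d τ‖ * Complex.exp (Complex.I * φ τ) := by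
  have hb : (2 * (d : ℂ) + 1) ≠ 0 := by exact_mod_cast (2 * d).succ_ne_zero
  have hre : ∀ τ : ℝ, 0 < (1 / 2 + Complex.I * τ : ℂ).re := fun τ => by simp
  have hne : ∀ τ, gammaCurve d τ ≠ 0 := fun τ =>
    mul_ne_zero (by simp [Complex.cpow_eq_zero_iff, hb])
      (Complex.Gamma_ne_zero_of_re_pos (hre τ))
  have hcont : Continuous (gammaCurve d) := by
    refine Continuous.mul ?_ ?_
    · exact Continuous.const_cpow (by fun_prop) (Or.inl hb)
    · refine continuous_iff_continuousAt.2 fun τ => ?_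
      have h := (Complex.differentiableAt_Gamma (1 / 2 + Complex.I * τ) fun m hm => by
        have h1 := hre τ
        rw [hm] at h1
        simp only [Complex.neg_re, Complex.natCast_re] at h1
        have : (0 : ℝ) ≤ m := Nat.cast_nonneg m
        linarith).continuousAt
      exact ContinuousAt.comp (f := fun τ : ℝ => (1 / 2 + Complex.I * τ : ℂ)) h
        (by fun_prop)
  have h0 : gammaCurve d 0 = ‖gammaCurve d 0‖ := by
    have : gammaCurve d 0 = (((2 * (d : ℝ) + 1) ^ (-(1 / 2) : ℝ) * Real.Gamma (1 / 2) : ℝ) : ℂ) := by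
      unfold gammaCurve
      rw [Complex.ofReal_mul, Complex.ofReal_cpow (by positivity), ← Complex.Gamma_ofReal]
      push_cast
      simp
    rw [this, Complex.norm_real, Real.norm_of_nonneg]
    have := Real.Gamma_pos_of_pos (by norm_num : (0 : ℝ) < 1 / 2)
    positivity
  have hn0 : ∀ τ, (‖gammaCurve d τ‖ : ℂ) ≠ 0 := fun τ => by simpa using hne τ
  have hu : ∀ τ, ‖gammaCurve d τ / ‖gammaCurve d τ‖‖ = 1 := fun τ => by
    rw [norm_div, Complex.norm_real, norm_norm, div_self (by simpa using hne τ)]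
  let g : C(ℝ, Circle) :=
    ⟨fun τ => ⟨gammaCurve d τ / ‖gammaCurve d τ‖, mem_sphere_zero_iff_norm.2 (hu τ)⟩,
      Continuous.subtype_mk (hcont.div (by fun_prop) hn0) _⟩
  have hg : ∀ (φ : ℝ → ℝ) (τ : ℝ), Circle.exp (φ τ) = g τ ↔
      gammaCurve d τ = ‖gammaCurve d τ‖ * Complex.exp (Complex.I * φ τ) := by
    intro φ τ
    rw [← Circle.coe_inj, Circle.coe_exp, mul_comm (Complex.I)]
    change _ = gammaCurve d τ / ‖gammaCurve d τ‖ ↔ _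
    rw [eq_div_iff (hn0 τ), mul_comm, eq_comm]
  have hg0 : Circle.exp 0 = g 0 := by
    have := (hg (fun _ => 0) 0).2 (by simpa using h0)
    simpa using this
  obtain ⟨F, ⟨hF0, hF⟩, huniq⟩ :=
    Circle.isCoveringMap_exp.existsUnique_continuousMap_lifts g 0 0 hg0
  refine ⟨F, ⟨F.continuous, hF0, fun τ => (hg F τ).1 (congrFun hF τ)⟩, ?_⟩
  rintro φ ⟨hφ, hφ0, hφe⟩
  have := huniq ⟨φ, hφ⟩ ⟨hφ0, funext fun τ => (hg φ τ).2 (hφe τ)⟩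
  exact congrArg DFunLike.coe this

/-- The continuous branch of `τ ↦ arg ((2d + 1)^{-1/2 - iτ} Γ(1/2 + iτ))` that is `0` at `τ = 0`,
where the curve meets the positive real axis. -/
noncomputable def gammaArg (d : ℕ) : ℝ → ℝ :=
  (existsUnique_gammaArg d).choose

/-- The number of roots of the Ehrhart polynomial whose imaginary part lies in `[a, b]`. -/
noncomputable def crossRootCount (d : ℕ) (a b : ℝ) : ℕ :=
  Set.ncard {z : ℂ | (crossEhrhart d).IsRoot z ∧ z.im ∈ Set.Icc a b}

/-! The roots are located by writing the Ehrhart polynomial on its critical line as the real part of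
an explicit oscillating integral and following the phase of that integral.

The lattice-point generating function gives a three-term recurrence in `d`. It is invariant, up to
sign, under `x ↦ -1 - x`, and it keeps ratios of consecutive polynomials in the right half-plane, so
all roots have real part `-1/2`. The Mellin transforms of `(1 - u)^d / (1 + u)^(d + 1)` on `[0, 1]`
satisfy the same recurrence up to sign. Hence `crossIntegral_add` expresses the polynomial at `s -
1`, times `Γ(s)Γ(1 - s)`, through the transforms at `s` and `1 - s`. On `s = 1/2 + iτ` these two are
conjugate, and a root occurs exactly when `i^d` times the transform is purely imaginary
(`isRoot_crossEhrhart_iff`).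

For large `d` the kernel is close to `exp(-(2d + 1)u)`, whose Mellin transform over the half-line is
`(2d + 1)^(-s) Γ(s)`, that is `gammaCurve`. The absolute error is `O(d^(-5/2))`, while for `|τ| ≤ T`
the curve has size at least of order `d^(-1/2) e^(-πT/2)`. With `T = log d + 1` the relative error
still tends to zero, because `π/2 < 19/10`. So the phase of the transform is `gammaArg` plus a
perturbation that is small and has a small Lipschitz constant (`exists_phase`).

Euler's product bounds the slope of the argument of `Γ(1/2 + iτ)` between `-3` and `log(2T + 2)`.
Therefore `gammaArg` decreases with slope about `-log d`, the perturbed phase is strictly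
decreasing, and roots correspond to its crossings of integers after normalization
(`exists_counting_phase`). The number of integers in an interval differs from its length by at most
`1`, and by a definite amount less if one endpoint keeps away from the integers; a root-free
neighbourhood of `a` or `b` provides such an endpoint. -/

/-! ### Three-term recurrence and the critical line -/

/-- The generating function in `m` is `(1 + t)^d (1 - t)^(-d - 1)`. The factor `2m + 1` acts on it
as `2 t d/dt + 1`, so the claim is an identity between rational functions of `t`, written with `P =
1/(1 - t)`. -/
theorem crossNumber_three_term (d m : ℕ) :
    ((d : ℤ) + 2) * crossNumber (d + 2) m =
      (2 * m + 1) * crossNumber (d + 1) m + (d + 1) * crossNumber d m := by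
  have hG : ∀ k : ℕ, (PowerSeries.mk (fun n => ((k + n).choose k : ℤ))) =
      (PowerSeries.mk 1 : PowerSeries ℤ) ^ (k + 1) := fun k =>
    (PowerSeries.mk_one_pow_eq_mk_choose_add ℤ k).symm
  set P : PowerSeries ℤ := PowerSeries.mk 1 with hP
  set t : PowerSeries ℤ := PowerSeries.X with ht
  have h1 : P * (1 - t) = 1 := PowerSeries.mk_one_mul_one_sub_eq_one ℤ
  have hc : ∀ k n, (crossNumber k n : ℤ) = PowerSeries.coeff n ((1 + t) ^ k * P ^ (k + 1)) := by
    intro k n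
    rw [crossNumber_coeff, hG]
  have hdt : PowerSeries.derivative ℤ t = 1 := PowerSeries.derivative_X
  have hdP : PowerSeries.derivative ℤ P = P ^ 2 := by
    have h := congrArg (PowerSeries.derivative ℤ) h1
    simp only [Derivation.leibniz, map_sub, smul_eq_mul, hdt, Derivation.map_one_eq_zero] at h
    linear_combination P * h - (PowerSeries.derivative ℤ P) * h1
  have hco : ∀ (f : PowerSeries ℤ) n,
      PowerSeries.coeff n (t * PowerSeries.derivative ℤ f) = n * PowerSeries.coeff n f := by
    intro f n
    cases n with
    | zero => simp [ht]
    | succ n =>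
      rw [mul_comm, PowerSeries.coeff_succ_mul_X, PowerSeries.coeff_derivative]
      push_cast
      ring
  have key : ((d + 2 : ℕ) : PowerSeries ℤ) * ((1 + t) ^ (d + 2) * P ^ (d + 2 + 1)) =
      2 * (t * PowerSeries.derivative ℤ ((1 + t) ^ (d + 1) * P ^ (d + 1 + 1))) +
      (1 + t) ^ (d + 1) * P ^ (d + 1 + 1) +
      ((d + 1 : ℕ) : PowerSeries ℤ) * ((1 + t) ^ d * P ^ (d + 1)) := by
    rw [Derivation.leibniz, Derivation.leibniz_pow, Derivation.leibniz_pow, map_add, hdt, hdP]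
    simp only [Derivation.map_one_eq_zero, smul_eq_mul, nsmul_eq_mul, Nat.add_sub_cancel]
    push_cast
    have e1 : P ^ (d + 2) = P ^ (d + 3) * (1 - t) := by linear_combination -P ^ (d + 2) * h1
    have e2 : P ^ (d + 1) = P ^ (d + 3) * (1 - t) ^ 2 := by
      linear_combination (-P ^ (d + 1)) * (1 + P * (1 - t)) * h1
    linear_combination (-(2 * t * (d + 1) * (1 + t) ^ d + (1 + t) ^ (d + 1))) * e1 -
      (d + 1) * (1 + t) ^ d * e2
  have := congrArg (PowerSeries.coeff m) key
  simp only [map_add, ← map_natCast (PowerSeries.C (R := ℤ)),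
    PowerSeries.coeff_C_mul, show (2 : PowerSeries ℤ) = PowerSeries.C (2 : ℤ) by simp, hco,
    ← hc] at this
  push_cast at this
  linear_combination this

theorem crossEhrhart_three_term (d : ℕ) (x : ℂ) :
    ((d : ℂ) + 2) * (crossEhrhart (d + 2)).eval x =
      (2 * x + 1) * (crossEhrhart (d + 1)).eval x + (d + 1) * (crossEhrhart d).eval x := by
  have h : Polynomial.C ((d : ℂ) + 2) * crossEhrhart (d + 2) =
      (Polynomial.C 2 * Polynomial.X + 1) * crossEhrhart (d + 1) +
        Polynomial.C ((d : ℂ) + 1) * crossEhrhart d := by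
    refine Polynomial.eq_of_infinite_eval_eq _ _
      (Set.Infinite.mono ?_ (Set.infinite_range_of_injective (Nat.cast_injective (R := ℂ))))
    rintro _ ⟨m, rfl⟩
    simp only [Set.mem_ofPred_eq, Polynomial.eval_mul, Polynomial.eval_add, Polynomial.eval_C,
      Polynomial.eval_X, Polynomial.eval_one, crossEhrhart_eval_crossNumber]
    exact_mod_cast crossNumber_three_term d m
  simpa using congrArg (Polynomial.eval x) h

theorem crossEhrhart_zero_eval (x : ℂ) : (crossEhrhart 0).eval x = 1 := by
  simp [crossEhrhart, shiftedBinomial]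

theorem crossEhrhart_one_eval (x : ℂ) : (crossEhrhart 1).eval x = 2 * x + 1 := by
  simp [crossEhrhart, shiftedBinomial, Finset.sum_range_succ]
  ring

/-- Dividing the recurrence by the middle polynomial gives `r' = ((2x + 1) + (d + 1)/r)/(d + 2)` for
consecutive ratios. Inversion preserves the open right half-plane, so positivity of the real part
propagates; carrying the ratio in the induction is what excludes zeros. -/
theorem crossEhrhart_ne_zero_of_re_pos {x : ℂ} (hx : 0 < (2 * x + 1).re) (d : ℕ) :
    (crossEhrhart d).eval x ≠ 0 ∧
      0 < ((crossEhrhart (d + 1)).eval x / (crossEhrhart d).eval x).re := by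
  induction d with
  | zero => simpa [crossEhrhart_zero_eval, crossEhrhart_one_eval] using hx
  | succ d ih =>
    obtain ⟨h0, h1⟩ := ih
    set r := (crossEhrhart (d + 1)).eval x / (crossEhrhart d).eval x with hr
    have hne : (crossEhrhart (d + 1)).eval x ≠ 0 := by
      intro h
      simp [hr, h] at h1
    refine ⟨hne, ?_⟩
    have hd : (d : ℂ) + 2 ≠ 0 := by exact_mod_cast (d + 1).succ_ne_zero
    have hrr : (crossEhrhart (d + 2)).eval x / (crossEhrhart (d + 1)).eval x =
        ((2 * x + 1) + ((d : ℝ) + 1 : ℝ) * r⁻¹) / ((d : ℝ) + 2 : ℝ) := by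
      rw [hr, inv_div]
      push_cast
      field_simp
      linear_combination crossEhrhart_three_term d x
    have hinv : 0 < (r⁻¹).re := by
      rw [Complex.inv_re]
      exact div_pos h1 (Complex.normSq_pos.2 (div_ne_zero hne h0))
    rw [hrr, Complex.div_ofReal_re, Complex.add_re, Complex.re_ofReal_mul]
    positivity

theorem crossEhrhart_eval_neg_one_sub (d : ℕ) (x : ℂ) :
    (crossEhrhart d).eval (-1 - x) = (-1) ^ d * (crossEhrhart d).eval x := by
  induction d using Nat.twoStepInduction with
  | zero => simp [crossEhrhart_zero_eval]
  | one =>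
    rw [crossEhrhart_one_eval, crossEhrhart_one_eval]
    ring
  | more d h0 h1 =>
    have hd : (d : ℂ) + 2 ≠ 0 := by exact_mod_cast (d + 1).succ_ne_zero
    refine mul_left_cancel₀ hd ?_
    rw [crossEhrhart_three_term, h0, h1]
    linear_combination (-(-1) ^ d) * crossEhrhart_three_term d x

/-- All roots of the Ehrhart polynomial lie on the critical line. -/
theorem re_eq_of_isRoot_crossEhrhart {d : ℕ} {x : ℂ} (hx : (crossEhrhart d).IsRoot x) :
    x.re = -1 / 2 := by
  rcases lt_trichotomy (x.re) (-1 / 2) with h | h | h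
  · exfalso
    refine (crossEhrhart_ne_zero_of_re_pos (x := -1 - x) ?_ d).1 ?_
    · simp
      linarith
    · rw [crossEhrhart_eval_neg_one_sub, hx, mul_zero]
  · exact h
  · exfalso
    refine (crossEhrhart_ne_zero_of_re_pos (x := x) ?_ d).1 hx
    simp
    linarith

/-! ### Integral representation and the root criterion -/

/-- The kernel `(1 - u)^d / (1 + u)^(d + 1)` of the integral representation. -/
noncomputable def crossKernel (d : ℕ) (u : ℝ) : ℝ :=
  (1 - u) ^ d / (1 + u) ^ (d + 1)

/-- The Mellin transform `∫₀¹ u^(s-1) (1 - u)^d / (1 + u)^(d + 1) du`. -/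
noncomputable def crossIntegral (d : ℕ) (s : ℂ) : ℂ :=
  ∫ u in (0 : ℝ)..1, (u : ℂ) ^ (s - 1) * (crossKernel d u : ℂ)

theorem continuousOn_crossKernel (d : ℕ) : ContinuousOn (crossKernel d) (Set.Icc 0 1) := by
  unfold crossKernel
  refine ContinuousOn.div (by fun_prop) (by fun_prop) fun u hu => ?_
  have := hu.1
  positivity

theorem intervalIntegrable_cpow_mul_crossKernel (d : ℕ) {s : ℂ} (hs : 0 < s.re) :
    IntervalIntegrable (fun u : ℝ => (u : ℂ) ^ (s - 1) * (crossKernel d u : ℂ))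
      MeasureTheory.volume 0 1 := by
  refine IntervalIntegrable.mul_continuousOn
    (intervalIntegral.intervalIntegrable_cpow' (by simpa using hs)) ?_
  rw [Set.uIcc_of_le zero_le_one]
  exact Complex.continuous_ofReal.comp_continuousOn (continuousOn_crossKernel d)

theorem continuousOn_cpow_mul_crossKernel (d : ℕ) {s : ℂ} (hs : 0 < s.re) :
    ContinuousOn (fun u : ℝ => (u : ℂ) ^ s * (crossKernel d u : ℂ)) (Set.Icc 0 1) :=
  (Complex.continuous_ofReal_cpow_const hs).continuousOn.mul
    (Complex.continuous_ofReal.comp_continuousOn (continuousOn_crossKernel d))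

theorem hasDerivAt_ofReal_cpow_mul {s : ℂ} {K : ℝ → ℝ} {K' u : ℝ} (hu : 0 < u)
    (hK : HasDerivAt K K' u) :
    HasDerivAt (fun u : ℝ => (u : ℂ) ^ s * (K u : ℂ))
      ((u : ℂ) ^ (s - 1) * (s * K u + u * K')) u := by
  have h0 : (u : ℂ) ≠ 0 := by exact_mod_cast hu.ne'
  have h1 : HasDerivAt (fun u : ℝ => (u : ℂ) ^ s) (s * (u : ℂ) ^ (s - 1) * 1) u :=
    HasDerivAt.comp_ofReal ((hasDerivAt_id (u : ℂ)).cpow_const (Complex.ofReal_mem_slitPlane.2 hu))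
  refine (h1.mul hK.ofReal_comp).congr_deriv ?_
  rw [Complex.cpow_sub _ _ h0, Complex.cpow_one]
  field_simp

/-- Integrate the derivative of `u^s/(1 + u)` over `[0, 1]`. The boundary value `1/2` at `u = 1`
produces the extra `1`, which cancels between `s` and `1 - s` in `crossIntegral_add`. -/
theorem crossIntegral_one {s : ℂ} (hs : 0 < s.re) :
    crossIntegral 1 s = -(2 * s - 1) * crossIntegral 0 s + 1 := by
  have hint0 := intervalIntegrable_cpow_mul_crossKernel 0 hs
  have hint1 := intervalIntegrable_cpow_mul_crossKernel 1 hs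
  have hF := intervalIntegral.integral_eq_sub_of_hasDerivAt_of_le (zero_le_one' ℝ)
    (continuousOn_cpow_mul_crossKernel 0 hs)
    (f' := fun u : ℝ => (1 / 2 : ℂ) * ((2 * s - 1) * ((u : ℂ) ^ (s - 1) * (crossKernel 0 u : ℂ)) +
      (u : ℂ) ^ (s - 1) * (crossKernel 1 u : ℂ))) (fun u hu => by
      have h1 : (1 + u) ≠ 0 := by linarith [hu.1]
      have h1' : (1 + u : ℂ) ≠ 0 := by exact_mod_cast h1
      have hK : HasDerivAt (crossKernel 0) (-1 / (1 + u) ^ 2) u := by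
        refine ((((hasDerivAt_id u).const_sub 1).pow 0).div (((hasDerivAt_id u).const_add 1).pow 1)
          (by simpa using h1)).congr_deriv ?_
        simp
      refine (hasDerivAt_ofReal_cpow_mul hu.1 hK).congr_deriv ?_
      simp only [crossKernel]
      push_cast
      field_simp
      ring) (((hint0.const_mul _).add hint1).const_mul _)
  rw [intervalIntegral.integral_const_mul, intervalIntegral.integral_add (hint0.const_mul _) hint1,
    intervalIntegral.integral_const_mul] at hF
  change (1 / 2 : ℂ) * ((2 * s - 1) * crossIntegral 0 s + crossIntegral 1 s) = _ at hF
  have hs0 : s ≠ 0 := by rintro rfl; simp at hs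
  simp only [crossKernel, Complex.ofReal_zero, Complex.zero_cpow hs0] at hF
  norm_num at hF
  linear_combination hF

/-- Integrate the derivative of `u^s` times the kernel of index `d + 1`: it vanishes at both
endpoints, so no boundary term survives. Compared with `crossEhrhart_three_term` at `x = s - 1` only
the sign of `2s - 1` differs, and the factor `(-1)^d` or the change to `1 - s` absorbs it. -/
theorem crossIntegral_three_term (d : ℕ) {s : ℂ} (hs : 0 < s.re) :
    ((d : ℂ) + 2) * crossIntegral (d + 2) s =
      -(2 * s - 1) * crossIntegral (d + 1) s + (d + 1) * crossIntegral d s := by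
  have hint0 := intervalIntegrable_cpow_mul_crossKernel d hs
  have hint1 := intervalIntegrable_cpow_mul_crossKernel (d + 1) hs
  have hint2 := intervalIntegrable_cpow_mul_crossKernel (d + 2) hs
  have hF := intervalIntegral.integral_eq_sub_of_hasDerivAt_of_le (zero_le_one' ℝ)
    (continuousOn_cpow_mul_crossKernel (d + 1) hs)
    (f' := fun u : ℝ => (1 / 2 : ℂ) *
      ((2 * s - 1) * ((u : ℂ) ^ (s - 1) * (crossKernel (d + 1) u : ℂ)) -
      (d + 1) * ((u : ℂ) ^ (s - 1) * (crossKernel d u : ℂ)) +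
      (d + 2) * ((u : ℂ) ^ (s - 1) * (crossKernel (d + 2) u : ℂ)))) (fun u hu => by
      have h1 : (1 + u) ≠ 0 := by linarith [hu.1]
      have h1' : (1 + u : ℂ) ≠ 0 := by exact_mod_cast h1
      have hK : HasDerivAt (crossKernel (d + 1)) (-(d + 1) * (1 - u) ^ d / (1 + u) ^ (d + 2) -
          (d + 2) * (1 - u) ^ (d + 1) / (1 + u) ^ (d + 3)) u := by
        refine ((((hasDerivAt_id u).const_sub 1).pow (d + 1)).div
          (((hasDerivAt_id u).const_add 1).pow (d + 2))
          (by simpa using h1)).congr_deriv ?_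
        simp
        field_simp
        ring
      refine (hasDerivAt_ofReal_cpow_mul hu.1 hK).congr_deriv ?_
      simp only [crossKernel]
      push_cast
      field_simp
      ring)
    ((((hint1.const_mul _).sub (hint0.const_mul _)).add (hint2.const_mul _)).const_mul _)
  rw [intervalIntegral.integral_const_mul, intervalIntegral.integral_add
      ((hint1.const_mul _).sub (hint0.const_mul _)) (hint2.const_mul _),
    intervalIntegral.integral_sub (hint1.const_mul _) (hint0.const_mul _),
    intervalIntegral.integral_const_mul, intervalIntegral.integral_const_mul,
    intervalIntegral.integral_const_mul] at hF
  change (1 / 2 : ℂ) * ((2 * s - 1) * crossIntegral (d + 1) s - (d + 1) * crossIntegral d s +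
    (d + 2) * crossIntegral (d + 2) s) = _ at hF
  have hs0 : s ≠ 0 := by rintro rfl; simp at hs
  simp only [crossKernel, Complex.ofReal_zero, Complex.zero_cpow hs0] at hF
  norm_num at hF
  linear_combination hF

/-- The integral representation of the Ehrhart polynomial. -/
theorem crossIntegral_add (d : ℕ) {s : ℂ} (hs : 0 < s.re) (hs' : s.re < 1) :
    crossIntegral d (1 - s) + (-1) ^ d * crossIntegral d s =
      (crossIntegral 0 (1 - s) + crossIntegral 0 s) * (crossEhrhart d).eval (s - 1) := by
  have ht : 0 < (1 - s).re := by simpa using hs'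
  induction d using Nat.twoStepInduction with
  | zero => simp [crossEhrhart_zero_eval]
  | one =>
    rw [crossEhrhart_one_eval, crossIntegral_one hs, crossIntegral_one ht]
    ring
  | more d h0 h1 =>
    have hd : (d : ℂ) + 2 ≠ 0 := by exact_mod_cast (d + 1).succ_ne_zero
    refine mul_left_cancel₀ hd ?_
    linear_combination crossIntegral_three_term d ht + (-1) ^ d * crossIntegral_three_term d hs -
      (crossIntegral 0 (1 - s) + crossIntegral 0 s) * crossEhrhart_three_term d (s - 1) +
      (d + 1) * h0 + (2 * s - 1) * h1

/-- The substitution `x = u/(1 + u)` maps `(0, 1]` onto `(0, 1/2]` and exhibits half of the Beta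
integral `B(s, 1 - s)`. The reflection `x ↦ 1 - x` will supply the other half. -/
theorem crossIntegral_zero_eq_integral_half (s : ℂ) :
    crossIntegral 0 s =
      ∫ x in (0 : ℝ)..(1 / 2), (x : ℂ) ^ (s - 1) * (1 - (x : ℂ)) ^ (-s) := by
  have himg : (fun u : ℝ => u / (1 + u)) '' Set.Ioc 0 1 = Set.Ioc 0 (1 / 2) := by
    ext x
    constructor
    · rintro ⟨u, hu, rfl⟩
      have := hu.1
      refine ⟨by positivity, ?_⟩
      simp only
      rw [div_le_div_iff₀ (by positivity) (by norm_num)]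
      linarith [hu.2]
    · intro hx
      have h1 : 0 < 1 - x := by linarith [hx.2]
      refine ⟨x / (1 - x), ⟨div_pos hx.1 h1, ?_⟩, ?_⟩
      · rw [div_le_one h1]
        linarith [hx.2]
      · simp only
        field_simp
        ring
  have hder : ∀ u ∈ Set.Ioc (0 : ℝ) 1,
      HasDerivWithinAt (fun u : ℝ => u / (1 + u)) (((1 + u) ^ 2)⁻¹) (Set.Ioc 0 1) u := by
    intro u hu
    have h1 : 1 + u ≠ 0 := by linarith [hu.1]
    refine (((hasDerivAt_id u).div ((hasDerivAt_id u).const_add 1) h1).congr_deriv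
      ?_).hasDerivWithinAt
    simp
  have hinj : Set.InjOn (fun u : ℝ => u / (1 + u)) (Set.Ioc 0 1) := by
    intro u hu v hv huv
    have h1 : 1 + u ≠ 0 := by linarith [hu.1]
    have h2 : 1 + v ≠ 0 := by linarith [hv.1]
    simp only at huv
    rw [div_eq_div_iff h1 h2] at huv
    linarith
  rw [intervalIntegral.integral_of_le (by norm_num), ← himg,
    MeasureTheory.integral_image_eq_integral_abs_deriv_smul measurableSet_Ioc hder hinj,
    crossIntegral, intervalIntegral.integral_of_le zero_le_one]
  refine MeasureTheory.setIntegral_congr_fun measurableSet_Ioc fun u hu => ?_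
  have hu0 := hu.1
  have h1 : 0 < 1 + u := by linarith
  have hc : ((1 + u : ℝ) : ℂ) ≠ 0 := by exact_mod_cast h1.ne'
  have e1 : (1 - ((u / (1 + u) : ℝ) : ℂ)) = (((1 + u : ℝ) : ℂ))⁻¹ := by
    rw [← Complex.ofReal_one, ← Complex.ofReal_sub, ← Complex.ofReal_inv]
    congr 1
    field_simp
    ring
  have e2 : ((u / (1 + u) : ℝ) : ℂ) ^ (s - 1) = (u : ℂ) ^ (s - 1) / ((1 + u : ℝ) : ℂ) ^ (s - 1) := by
    rw [Complex.ofReal_div, Complex.div_cpow_ofReal_nonneg hu0.le h1.le]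
  have e3 : (((1 + u : ℝ) : ℂ))⁻¹ ^ (-s) = ((1 + u : ℝ) : ℂ) ^ (s - 1) * ((1 + u : ℝ) : ℂ) := by
    rw [Complex.inv_cpow _ _ (by
      rw [Complex.arg_ofReal_of_nonneg h1.le]
      exact Real.pi_pos.ne), Complex.cpow_neg, inv_inv, Complex.cpow_sub _ _ hc, Complex.cpow_one,
      div_mul_cancel₀ _ hc]
  have hp : ((1 + u : ℝ) : ℂ) ^ (s - 1) ≠ 0 := fun h => hc ((Complex.cpow_eq_zero_iff _ _).1 h).1
  simp only [abs_of_pos (inv_pos.2 (pow_pos h1 2)), e1, e2, e3, Complex.real_smul, crossKernel,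
    pow_zero, zero_add, pow_one, one_div, Complex.ofReal_inv, Complex.ofReal_pow]
  field_simp

theorem crossIntegral_zero_add {s : ℂ} (hs : 0 < s.re) (hs' : s.re < 1) :
    crossIntegral 0 (1 - s) + crossIntegral 0 s = Complex.Gamma s * Complex.Gamma (1 - s) := by
  have ht : 0 < (1 - s).re := by simpa using hs'
  have hb := Complex.betaIntegral_convergent hs ht
  rw [Complex.Gamma_mul_Gamma_eq_betaIntegral hs ht, add_sub_cancel, Complex.Gamma_one, one_mul,
    Complex.betaIntegral, ← intervalIntegral.integral_add_adjacent_intervals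
      (b := (1 / 2 : ℝ)) (hb.mono_set ?_) (hb.mono_set ?_), add_comm,
    crossIntegral_zero_eq_integral_half, crossIntegral_zero_eq_integral_half]
  · congr 1
    · rw [show (1 - s - 1 : ℂ) = -s by ring]
    · have := intervalIntegral.integral_comp_sub_left (a := 0) (b := 1 / 2)
        (fun x : ℝ => (x : ℂ) ^ (s - 1) * (1 - (x : ℂ)) ^ (1 - s - 1)) 1
      rw [show (1 : ℝ) - 1 / 2 = 1 / 2 by norm_num, sub_zero] at this
      rw [← this]
      refine intervalIntegral.integral_congr fun x _ => ?_
      rw [show -(1 - s) = s - 1 by ring, show (1 - s - 1) = -s by ring]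
      push_cast
      rw [sub_sub_cancel, mul_comm]
  · rw [Set.uIcc_of_le (by norm_num), Set.uIcc_of_le (by norm_num)]
    exact Set.Icc_subset_Icc le_rfl (by norm_num)
  · rw [Set.uIcc_of_le (by norm_num), Set.uIcc_of_le (by norm_num)]
    exact Set.Icc_subset_Icc (by norm_num) le_rfl

theorem conj_crossIntegral (d : ℕ) (s : ℂ) :
    (starRingEnd ℂ) (crossIntegral d s) = crossIntegral d ((starRingEnd ℂ) s) := by
  rw [crossIntegral, crossIntegral, intervalIntegral.integral_of_le zero_le_one,
    intervalIntegral.integral_of_le zero_le_one, ← integral_conj]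
  refine MeasureTheory.setIntegral_congr_fun measurableSet_Ioc fun u hu => ?_
  simp only [map_mul, Complex.conj_ofReal]
  congr 1
  have harg : (u : ℂ).arg ≠ Real.pi := by
    rw [Complex.arg_ofReal_of_nonneg hu.1.le]
    exact Real.pi_pos.ne
  have := Complex.cpow_conj (u : ℂ) (s - 1) harg
  rw [Complex.conj_ofReal, map_sub, map_one] at this
  exact this.symm

/-- A point of the critical line is a root exactly if `i^d ∫₀¹ u^(s-1) (1-u)^d/(1+u)^(d+1) du`
is purely imaginary. -/
theorem isRoot_crossEhrhart_iff (d : ℕ) (τ : ℝ) :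
    (crossEhrhart d).IsRoot (-1 / 2 + Complex.I * τ) ↔
      (Complex.I ^ d * crossIntegral d (1 / 2 + Complex.I * τ)).re = 0 := by
  set s : ℂ := 1 / 2 + Complex.I * τ with hs
  have hre : s.re = 1 / 2 := by simp [hs]
  have h0 : 0 < s.re := by rw [hre]; norm_num
  have h1 : s.re < 1 := by rw [hre]; norm_num
  have hconj : (starRingEnd ℂ) s = 1 - s := by
    simp [hs, Complex.ext_iff]
    norm_num
  have hV := crossIntegral_add d h0 h1
  rw [crossIntegral_zero_add h0 h1] at hV
  have hne : Complex.Gamma s * Complex.Gamma (1 - s) ≠ 0 :=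
    mul_ne_zero (Complex.Gamma_ne_zero_of_re_pos h0)
      (Complex.Gamma_ne_zero_of_re_pos (by simpa using h1))
  have hsub : (-1 / 2 + Complex.I * τ : ℂ) = s - 1 := by rw [hs]; ring
  have hI : (starRingEnd ℂ) (Complex.I ^ d) = (-1) ^ d * Complex.I ^ d := by
    rw [map_pow, Complex.conj_I, ← mul_pow, neg_one_mul]
  -- Twice the real part is the sum with the conjugate, and conjugation replaces `s` by `1 - s`; up
  -- to the unit `(-1)^d * I^d` this is the left side of the integral representation.
  have h2 : (((Complex.I ^ d * crossIntegral d s).re : ℝ) : ℂ) * 2 =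
      (-1) ^ d * Complex.I ^ d * (Complex.Gamma s * Complex.Gamma (1 - s)) *
        (crossEhrhart d).eval (s - 1) := by
    have hm : ((-1 : ℂ) ^ d) * (-1) ^ d = 1 := by rw [← mul_pow]; simp
    rw [Complex.re_eq_add_conj, map_mul, hI, conj_crossIntegral, hconj]
    linear_combination (-1) ^ d * Complex.I ^ d * hV -
      Complex.I ^ d * crossIntegral d s * hm
  have h3 : ((Complex.I ^ d * crossIntegral d s).re : ℂ) = 0 ↔
      ((Complex.I ^ d * crossIntegral d s).re : ℂ) * 2 = 0 := by simp
  rw [hsub, Polynomial.IsRoot.def, ← Complex.ofReal_eq_zero, h3, h2]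
  constructor
  · intro h
    rw [h, mul_zero]
  · intro h
    exact (mul_eq_zero.1 h).resolve_left
      (mul_ne_zero (mul_ne_zero (by simp) (by simp)) hne)

/-! ### The continuous argument of Γ(1/2 + iτ) -/

/-- The argument of Euler's approximation `Complex.GammaSeq (1 / 2 + i τ) n`. -/
noncomputable def gammaSeqPhase (n : ℕ) (τ : ℝ) : ℝ :=
  τ * Real.log n - ∑ j ∈ Finset.range (n + 1), Real.arctan (τ / (j + 1 / 2))

theorem half_add_eq_norm_mul_exp_arctan {x : ℝ} (hx : 0 < x) (τ : ℝ) :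
    (x + Complex.I * τ : ℂ) =
      ‖(x + Complex.I * τ : ℂ)‖ * Complex.exp (Complex.I * Real.arctan (τ / x)) := by
  have hre : (x + Complex.I * τ : ℂ).re = x := by simp
  have him : (x + Complex.I * τ : ℂ).im = τ := by simp
  have harg := abs_lt.1 (Complex.abs_arg_lt_pi_div_two_iff.2 (Or.inl (hre ▸ hx)))
  have h : Real.arctan (τ / x) = (x + Complex.I * τ : ℂ).arg := by
    rw [← Real.arctan_tan harg.1 harg.2, Complex.tan_arg, hre, him]
  rw [h, mul_comm Complex.I (Complex.arg _ : ℂ), Complex.norm_mul_exp_arg_mul_I]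

theorem GammaSeq_eq_norm_mul_exp {n : ℕ} (hn : n ≠ 0) (τ : ℝ) :
    Complex.GammaSeq (1 / 2 + Complex.I * τ) n =
      ‖Complex.GammaSeq (1 / 2 + Complex.I * τ) n‖ *
        Complex.exp (Complex.I * gammaSeqPhase n τ) := by
  have hn0 : (n : ℂ) ≠ 0 := by exact_mod_cast hn
  have hn1 : (0 : ℝ) < n := by positivity
  have e1 : (n : ℂ) ^ (1 / 2 + Complex.I * τ : ℂ) =
      ‖(n : ℂ) ^ (1 / 2 + Complex.I * τ : ℂ)‖ * Complex.exp (Complex.I * (τ * Real.log n : ℝ)) := by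
    rw [Complex.norm_natCast_cpow_of_pos (Nat.pos_of_ne_zero hn), Complex.cpow_add _ _ hn0]
    congr 1
    · simp only [Complex.add_re, Complex.mul_re, Complex.I_re, Complex.I_im, Complex.ofReal_im]
      rw [Complex.ofReal_cpow hn1.le]
      norm_num
    · rw [Complex.cpow_def_of_ne_zero hn0, ← Complex.natCast_log]
      push_cast
      ring_nf
  have e2 : ∏ j ∈ Finset.range (n + 1), (1 / 2 + Complex.I * τ + j : ℂ) =
      ‖∏ j ∈ Finset.range (n + 1), (1 / 2 + Complex.I * τ + j : ℂ)‖ *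
        Complex.exp (Complex.I *
          (∑ j ∈ Finset.range (n + 1), Real.arctan (τ / (j + 1 / 2)) : ℝ)) := by
    rw [norm_prod, Complex.ofReal_prod, Complex.ofReal_sum, Finset.mul_sum, Complex.exp_sum,
      ← Finset.prod_mul_distrib]
    refine Finset.prod_congr rfl fun j _ => ?_
    have := half_add_eq_norm_mul_exp_arctan (x := j + 1 / 2) (by positivity) τ
    rw [show (1 / 2 + Complex.I * τ + j : ℂ) = ((j + 1 / 2 : ℝ) : ℂ) + Complex.I * τ by
      push_cast; ring]
    exact this
  rw [Complex.GammaSeq, norm_div, norm_mul, gammaSeqPhase, Complex.ofReal_sub, mul_sub,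
    Complex.exp_sub, Complex.norm_natCast]
  conv_lhs => rw [e1, e2]
  push_cast
  ring

theorem hasDerivAt_gammaSeqPhase (n : ℕ) (τ : ℝ) :
    HasDerivAt (gammaSeqPhase n) (Real.log n -
      ∑ j ∈ Finset.range (n + 1), ((j : ℝ) + 1 / 2) / (((j : ℝ) + 1 / 2) ^ 2 + τ ^ 2)) τ := by
  unfold gammaSeqPhase
  have h1 : HasDerivAt (fun τ : ℝ => ∑ j ∈ Finset.range (n + 1), Real.arctan (τ / (j + 1 / 2)))
      (∑ j ∈ Finset.range (n + 1), ((j : ℝ) + 1 / 2) / (((j : ℝ) + 1 / 2) ^ 2 + τ ^ 2)) τ := by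
    refine HasDerivAt.fun_sum fun j _ => ?_
    have hj : (0 : ℝ) < j + 1 / 2 := by positivity
    refine ((hasDerivAt_id τ).div_const ((j : ℝ) + 1 / 2)).arctan.congr_deriv ?_
    simp only [id]
    field_simp
  exact (((hasDerivAt_id τ).mul_const (Real.log n)).sub h1).congr_deriv (by simp)

/-- Drop `τ`: the term `j = 0` contributes at most `2` and the others at most the harmonic sum `1 +
log n`. The `log n` cancels in the derivative of `gammaSeqPhase`, leaving `-3` uniformly in `n`. -/
theorem sum_div_sq_add_sq_le (n : ℕ) (τ : ℝ) :
    ∑ j ∈ Finset.range (n + 1), ((j : ℝ) + 1 / 2) / (((j : ℝ) + 1 / 2) ^ 2 + τ ^ 2) ≤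
      Real.log n + 3 := by
  have h : ∀ x : ℝ, 0 < x → x / (x ^ 2 + τ ^ 2) ≤ 1 / x := fun x hx => by
    rw [div_le_div_iff₀ (by positivity) hx]
    nlinarith [sq_nonneg τ]
  rw [Finset.sum_range_succ']
  have h0 := h (((0 : ℕ) : ℝ) + 1 / 2) (by positivity)
  have h1 : ∑ j ∈ Finset.range n, (((j + 1 : ℕ) : ℝ) + 1 / 2) /
      ((((j + 1 : ℕ) : ℝ) + 1 / 2) ^ 2 + τ ^ 2) ≤ (harmonic n : ℝ) := by
    rw [harmonic]
    push_cast
    refine Finset.sum_le_sum fun j _ => ?_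
    have := h ((j : ℝ) + 1 + 1 / 2) (by positivity)
    refine this.trans ?_
    rw [← one_div ((j : ℝ) + 1)]
    exact one_div_le_one_div_of_le (by positivity) (by linarith)
  have h2 := harmonic_le_one_add_log n
  norm_num at h0 h1 ⊢
  linarith

/-- Once `x = n + 1/2` exceeds `T`, each term is at least `1/(x + T)`, which dominates the increment
of `log(x + T)`. Before that the left side is not positive. The resulting loss `log(2T + 2)` is only
doubly logarithmic in `d` when `T` is about `log d`. -/
theorem log_sub_le_sum_div_sq_add_sq {T : ℝ} (hT : 0 ≤ T) {τ : ℝ} (hτ : |τ| ≤ T) (n : ℕ) :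
    Real.log ((n : ℝ) + 1 / 2 + T) - Real.log (2 * T + 2) ≤
      ∑ j ∈ Finset.range n, ((j : ℝ) + 1 / 2) / (((j : ℝ) + 1 / 2) ^ 2 + τ ^ 2) := by
  have hnn : ∀ n : ℕ,
      0 ≤ ∑ j ∈ Finset.range n, ((j : ℝ) + 1 / 2) / (((j : ℝ) + 1 / 2) ^ 2 + τ ^ 2) := fun n =>
    Finset.sum_nonneg fun j _ => by positivity
  have hsmall : ∀ n : ℕ, (n : ℝ) + 1 / 2 ≤ T + 1 →
      Real.log ((n : ℝ) + 1 / 2 + T) - Real.log (2 * T + 2) ≤ 0 := by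
    intro n hn
    rw [sub_nonpos]
    exact Real.log_le_log (by positivity) (by linarith)
  induction n with
  | zero => exact (hsmall 0 (by push_cast; linarith)).trans (hnn 0)
  | succ n ih =>
    rcases le_or_gt (((n + 1 : ℕ) : ℝ) + 1 / 2) (T + 1) with h | h
    · exact (hsmall _ h).trans (hnn _)
    · rw [Finset.sum_range_succ]
      push_cast at h ⊢
      have hx : T < (n : ℝ) + 1 / 2 := by linarith
      set x : ℝ := (n : ℝ) + 1 / 2 with hxdef
      have hx0 : 0 < x := by positivity
      have hτ2 : τ ^ 2 ≤ T ^ 2 := by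
        rw [← sq_abs]
        gcongr
      have h1 : 1 / (x + T) ≤ x / (x ^ 2 + τ ^ 2) := by
        rw [div_le_div_iff₀ (by positivity) (by positivity)]
        nlinarith
      have h2 : Real.log (n + 1 + 1 / 2 + T) - Real.log (x + T) ≤ 1 / (x + T) := by
        rw [← Real.log_div (by positivity) (by positivity)]
        refine (Real.log_le_sub_one_of_pos (by positivity)).trans (le_of_eq ?_)
        rw [hxdef]
        field_simp
        ring
      linarith

theorem gammaSeqPhase_sub {n : ℕ} (hn : n ≠ 0) {T a b : ℝ} (ha : -T ≤ a) (hab : a ≤ b)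
    (hb : b ≤ T) :
    -3 * (b - a) ≤ gammaSeqPhase n b - gammaSeqPhase n a ∧
      gammaSeqPhase n b - gammaSeqPhase n a ≤ Real.log (2 * T + 2) * (b - a) := by
  have hT : 0 ≤ T := by linarith
  have hd : ∀ τ, deriv (gammaSeqPhase n) τ = _ := fun τ => (hasDerivAt_gammaSeqPhase n τ).deriv
  have hc : Differentiable ℝ (gammaSeqPhase n) := fun τ =>
    (hasDerivAt_gammaSeqPhase n τ).differentiableAt
  constructor
  · refine (convex_Icc (-T) T).mul_sub_le_image_sub_of_le_deriv hc.continuous.continuousOn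
      hc.differentiableOn (fun τ _ => ?_) a ⟨ha, hab.trans hb⟩ b ⟨ha.trans hab, hb⟩ hab
    rw [hd]
    linarith [sum_div_sq_add_sq_le n τ]
  · refine (convex_Icc (-T) T).image_sub_le_mul_sub_of_deriv_le hc.continuous.continuousOn
      hc.differentiableOn (fun τ hτ => ?_) a ⟨ha, hab.trans hb⟩ b ⟨ha.trans hab, hb⟩ hab
    rw [interior_Icc] at hτ
    rw [hd]
    have h1 := log_sub_le_sum_div_sq_add_sq hT (abs_le.2 ⟨hτ.1.le, hτ.2.le⟩) (n + 1)
    have h2 : Real.log n ≤ Real.log (((n + 1 : ℕ) : ℝ) + 1 / 2 + T) := by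
      refine Real.log_le_log (by positivity) ?_
      push_cast
      linarith
    linarith

theorem gammaArg_spec (d : ℕ) : Continuous (gammaArg d) ∧ gammaArg d 0 = 0 ∧
    ∀ τ, gammaCurve d τ = ‖gammaCurve d τ‖ * Complex.exp (Complex.I * gammaArg d τ) :=
  (existsUnique_gammaArg d).choose_spec.1

theorem eq_gammaArg {d : ℕ} {φ : ℝ → ℝ} (hφ : Continuous φ) (hφ0 : φ 0 = 0)
    (h : ∀ τ, gammaCurve d τ = ‖gammaCurve d τ‖ * Complex.exp (Complex.I * φ τ)) :
    gammaArg d = φ :=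
  ((existsUnique_gammaArg d).choose_spec.2 φ ⟨hφ, hφ0, h⟩).symm

/-- The continuous argument of `Γ(1/2 + iτ)` grows with slope between `-3` and
`log (2T + 2)` on `[-T, T]`. -/
theorem exists_arg_Gamma : ∃ F : ℝ → ℝ,
    (∀ T a b : ℝ, -T ≤ a → a ≤ b → b ≤ T →
      -3 * (b - a) ≤ F b - F a ∧ F b - F a ≤ Real.log (2 * T + 2) * (b - a)) ∧
    ∀ d τ, gammaArg d τ = F τ - τ * Real.log (2 * d + 1) := by
  -- Boundedness alone gives a limit along an ultrafilter, so convergence of the phases need not be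
  -- proved. The slope bounds pass to this limit, and convergence of `Complex.GammaSeq` shows that
  -- it is an argument of Γ.
  have hU : ∀ τ, ∃ y, Tendsto (fun n => gammaSeqPhase n τ) (hyperfilter ℕ : Filter ℕ) (𝓝 y) := by
    intro τ
    have hbd : ∀ n ≠ 0, gammaSeqPhase n τ ∈
        Set.Icc (-(3 + Real.log (2 * |τ| + 2)) * |τ|) ((3 + Real.log (2 * |τ| + 2)) * |τ|) := by
      intro n hn
      have h0 : gammaSeqPhase n 0 = 0 := by simp [gammaSeqPhase]
      have hl : 0 ≤ Real.log (2 * |τ| + 2) := Real.log_nonneg (by linarith [abs_nonneg τ])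
      rcases le_total 0 τ with h | h
      · have := gammaSeqPhase_sub hn (T := |τ|) (by linarith [abs_nonneg τ]) h (le_abs_self τ)
        rw [h0, sub_zero, sub_zero] at this
        rw [abs_of_nonneg h] at *
        constructor <;> nlinarith
      · have := gammaSeqPhase_sub hn (T := |τ|) (neg_abs_le τ) h (abs_nonneg τ)
        rw [h0, zero_sub, zero_sub] at this
        rw [abs_of_nonpos h] at *
        constructor <;> nlinarith
    obtain ⟨y, -, hy⟩ := isCompact_Icc.ultrafilter_le_nhds
      ((hyperfilter ℕ).map fun n => gammaSeqPhase n τ) (by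
        rw [Filter.le_principal_iff]
        have : ∀ᶠ n in (hyperfilter ℕ : Filter ℕ), n ≠ 0 :=
          Nat.hyperfilter_le_atTop (eventually_ne_atTop 0)
        exact this.mono hbd)
    exact ⟨y, hy⟩
  choose F hF using hU
  have hne : ∀ᶠ n in (hyperfilter ℕ : Filter ℕ), n ≠ 0 :=
    Nat.hyperfilter_le_atTop (eventually_ne_atTop 0)
  have hsub : ∀ T a b : ℝ, -T ≤ a → a ≤ b → b ≤ T →
      -3 * (b - a) ≤ F b - F a ∧ F b - F a ≤ Real.log (2 * T + 2) * (b - a) := by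
    intro T a b ha hab hb
    have ht := (hF b).sub (hF a)
    exact ⟨ge_of_tendsto ht (hne.mono fun n hn => (gammaSeqPhase_sub hn ha hab hb).1),
      le_of_tendsto ht (hne.mono fun n hn => (gammaSeqPhase_sub hn ha hab hb).2)⟩
  have hF0 : F 0 = 0 := by
    refine tendsto_nhds_unique (hF 0) ?_
    simp [gammaSeqPhase]
  have hcont : Continuous F := by
    refine continuous_iff_continuousAt.2 fun τ => ?_
    set T := |τ| + 1 with hT
    have hTpos : 0 < T := by positivity
    have hl : 0 ≤ Real.log (2 * T + 2) := Real.log_nonneg (by linarith)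
    have hlip : LipschitzOnWith (Real.toNNReal (3 + Real.log (2 * T + 2))) F (Set.Icc (-T) T) := by
      refine LipschitzOnWith.of_dist_le_mul fun x hx y hy => ?_
      rw [Real.coe_toNNReal _ (by positivity), Real.dist_eq, Real.dist_eq, abs_le]
      rcases le_total x y with h | h
      · have := hsub T x y hx.1 h hy.2
        rw [abs_of_nonpos (by linarith : x - y ≤ 0)]
        constructor <;> nlinarith
      · have := hsub T y x hy.1 h hx.2
        rw [abs_of_nonneg (by linarith : 0 ≤ x - y)]
        constructor <;> nlinarith
    exact hlip.continuousOn.continuousAt (Icc_mem_nhds (by linarith [neg_abs_le τ])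
      (by linarith [le_abs_self τ]))
  have hΓ : ∀ τ : ℝ, Complex.Gamma (1 / 2 + Complex.I * τ) =
      ‖Complex.Gamma (1 / 2 + Complex.I * τ)‖ * Complex.exp (Complex.I * F τ) := by
    intro τ
    have h1 : Tendsto (Complex.GammaSeq (1 / 2 + Complex.I * τ)) (hyperfilter ℕ : Filter ℕ)
        (𝓝 (Complex.Gamma (1 / 2 + Complex.I * τ))) :=
      (Complex.GammaSeq_tendsto_Gamma _).mono_left Nat.hyperfilter_le_atTop
    refine tendsto_nhds_unique h1 ?_
    have h2 := ((Complex.continuous_ofReal.tendsto _).comp h1.norm).mul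
      ((Complex.continuous_exp.tendsto _).comp
        (((Complex.continuous_ofReal.tendsto _).comp (hF τ)).const_mul Complex.I))
    refine h2.congr' (hne.mono fun n hn => ?_)
    simpa using (GammaSeq_eq_norm_mul_exp hn τ).symm
  refine ⟨F, hsub, fun d τ => ?_⟩
  -- The power `(2d + 1)^(-1/2 - iτ)` has argument `-τ log(2d + 1)`; uniqueness of the continuous
  -- branch does the rest.
  have := eq_gammaArg (d := d) (φ := fun τ => F τ - τ * Real.log (2 * d + 1)) (by fun_prop)
    (by simp [hF0]) (fun τ => by
      have hb : (0 : ℝ) < 2 * d + 1 := by positivity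
      have hbc : (2 * (d : ℂ) + 1) = ((2 * d + 1 : ℝ) : ℂ) := by push_cast; ring
      have hb0 : ((2 * d + 1 : ℝ) : ℂ) ≠ 0 := by exact_mod_cast hb.ne'
      have e1 : (2 * (d : ℂ) + 1) ^ (-(1 / 2 : ℂ) - Complex.I * τ) =
          ‖(2 * (d : ℂ) + 1) ^ (-(1 / 2 : ℂ) - Complex.I * τ)‖ *
            Complex.exp (-(Complex.I * (τ * Real.log (2 * d + 1) : ℝ))) := by
        rw [hbc, Complex.norm_cpow_eq_rpow_re_of_pos hb, Complex.cpow_sub _ _ hb0,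
          Complex.exp_neg, ← div_eq_mul_inv]
        congr 1
        · simp only [Complex.sub_re, Complex.mul_re, Complex.I_re, Complex.I_im, Complex.ofReal_im]
          rw [Complex.ofReal_cpow hb.le]
          norm_num
        · rw [Complex.cpow_def_of_ne_zero hb0, ← Complex.ofReal_log hb.le]
          push_cast
          ring_nf
      rw [gammaCurve, norm_mul]
      conv_lhs => rw [e1, hΓ τ]
      rw [Complex.ofReal_sub, mul_sub, Complex.exp_sub, Complex.exp_neg]
      push_cast
      ring)
  rw [this]

/-! ### Exponential approximation of the kernel -/

/-- With `exp(2u) ≥ 1 + 2u + 2u²` the quadratic terms cancel: `(1 - u)(1 + 2u + 2u²) = 1 + u - 2u³`.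
-/
theorem one_sub_two_mul_cube_le {u : ℝ} (hu : 0 ≤ u) (hu1 : u ≤ 1) :
    1 - 2 * u ^ 3 ≤ (1 - u) * Real.exp (2 * u) / (1 + u) := by
  rw [le_div_iff₀ (by positivity)]
  have h := Real.quadratic_le_exp_of_nonneg (by positivity : 0 ≤ 2 * u)
  have := mul_le_mul_of_nonneg_left h (by linarith : 0 ≤ 1 - u)
  nlinarith [pow_nonneg hu 4, pow_nonneg hu 3]

/-- The product splits as `q^d · e^u/(1 + u)` with `q = (1 - u)e^(2u)/(1 + u)`. Bernoulli's
inequality puts the first factor in `[1 - 2du³, 1]`, and the second lies in `[1, 1 + u²]`. -/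
theorem abs_crossKernel_mul_exp_sub_one_le (d : ℕ) {u : ℝ} (hu : 0 ≤ u) (hu1 : u ≤ 1) :
    |crossKernel d u * Real.exp ((2 * d + 1) * u) - 1| ≤ u ^ 2 + 2 * d * u ^ 3 := by
  set q : ℝ := (1 - u) * Real.exp (2 * u) / (1 + u) with hq
  have hK : crossKernel d u * Real.exp ((2 * d + 1) * u) = q ^ d * (Real.exp u / (1 + u)) := by
    rw [crossKernel, hq, div_pow, mul_pow, ← Real.exp_nat_mul,
      show (2 * (d : ℝ) + 1) * u = d * (2 * u) + u by ring, Real.exp_add]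
    field_simp
    ring
  have hq0 : 0 ≤ q := by
    have : 0 ≤ 1 - u := by linarith
    positivity
  have hq1 : q ≤ 1 := by
    rw [hq, div_le_one (by positivity)]
    rcases hu1.eq_or_lt with rfl | h
    · norm_num
    · have h1 : 0 < 1 - u := by linarith
      have hl := Real.sum_range_le_log_div hu h 1
      norm_num at hl
      have := Real.exp_le_exp.2 (by linarith : 2 * u ≤ Real.log ((1 + u) / (1 - u)))
      rw [Real.exp_log (by positivity), le_div_iff₀ h1] at this
      linarith
  have he1 : 1 ≤ Real.exp u / (1 + u) := by
    rw [le_div_iff₀ (by positivity)]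
    linarith [Real.add_one_le_exp u]
  have he2 : Real.exp u / (1 + u) ≤ 1 + u ^ 2 := by
    rw [div_le_iff₀ (by positivity)]
    have := (abs_le.1 (Real.abs_exp_sub_one_sub_id_le (x := u) (by rwa [abs_of_nonneg hu]))).2
    nlinarith [pow_nonneg hu 3]
  have hB : 1 - 2 * d * u ^ 3 ≤ q ^ d := by
    have := one_add_mul_sub_le_pow (by linarith : -1 ≤ q) d
    have h3 := one_sub_two_mul_cube_le hu hu1
    nlinarith [(Nat.cast_nonneg d : (0 : ℝ) ≤ d)]
  have hqd : q ^ d ≤ 1 := pow_le_one₀ hq0 hq1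
  have hqd0 : 0 ≤ q ^ d := pow_nonneg hq0 d
  have hd3 : 0 ≤ 2 * (d : ℝ) * u ^ 3 := by positivity
  rw [hK, abs_le]
  constructor <;> nlinarith [sq_nonneg u]

/-- The difference of the kernel, extended by zero beyond `1`, and its exponential
approximation. -/
noncomputable def kernelError (d : ℕ) (u : ℝ) : ℝ :=
  (Set.Iic 1).indicator (crossKernel d) u - Real.exp (-((2 * d + 1) * u))

theorem abs_kernelError_le (d : ℕ) {u : ℝ} (hu : 0 ≤ u) :
    |kernelError d u| ≤ (u ^ 2 + (2 * d + 1) * u ^ 3) * Real.exp (-((2 * d + 1) * u)) := by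
  have he := Real.exp_pos (-((2 * d + 1) * u))
  have hu3 : 0 ≤ u ^ 3 := by positivity
  rcases le_or_gt u 1 with h | h
  · have h1 : kernelError d u = (crossKernel d u * Real.exp ((2 * d + 1) * u) - 1) *
        Real.exp (-((2 * d + 1) * u)) := by
      rw [kernelError, Set.indicator_of_mem (Set.mem_Iic.2 h), sub_mul, mul_assoc, ← Real.exp_add]
      simp
    rw [h1, abs_mul, abs_of_pos he]
    refine mul_le_mul_of_nonneg_right
      ((abs_crossKernel_mul_exp_sub_one_le d hu h).trans ?_) he.le
    linarith
  -- Beyond `1` the error is the exponential itself, and there `u² ≥ 1` already makes the bound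
  -- trivial.
  · rw [kernelError, Set.indicator_of_notMem (by simpa using h), zero_sub, abs_neg, abs_of_pos he]
    refine le_mul_of_one_le_left he.le ?_
    have : 0 ≤ (2 * (d : ℝ) + 1) * u ^ 3 := by positivity
    nlinarith

/-- The error of the approximation of the integral by the curve `gammaCurve`. -/
noncomputable def curveError (d : ℕ) (τ : ℝ) : ℂ :=
  crossIntegral d (1 / 2 + Complex.I * τ) - gammaCurve d τ

theorem integrableOn_rpow_mul_exp_neg {a r : ℝ} (ha : 0 < a) (hr : 0 < r) :
    MeasureTheory.IntegrableOn (fun u : ℝ => u ^ (a - 1) * Real.exp (-(r * u))) (Set.Ioi 0) := by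
  have := integrableOn_rpow_mul_exp_neg_mul_rpow (s := a - 1) (p := 1) (b := r) (by linarith)
    one_pos hr
  simpa using this

/-- Since `gammaCurve` is the Mellin transform of `exp(-(2d + 1)u)` over the whole half-line, the
error is the Mellin transform of `kernelError`. -/
theorem curveError_eq (d : ℕ) (τ : ℝ) :
    MeasureTheory.IntegrableOn
      (fun u : ℝ => (u : ℂ) ^ (1 / 2 + Complex.I * τ - 1) * (kernelError d u : ℂ)) (Set.Ioi 0) ∧
    curveError d τ =
      ∫ u in Set.Ioi (0 : ℝ), (u : ℂ) ^ (1 / 2 + Complex.I * τ - 1) * (kernelError d u : ℂ) := by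
  set s : ℂ := 1 / 2 + Complex.I * τ with hs
  have hre : s.re = 1 / 2 := by simp [hs]
  have hn : (0 : ℝ) < 2 * d + 1 := by positivity
  have hnc : (2 * (d : ℂ) + 1) = ((2 * d + 1 : ℝ) : ℂ) := by push_cast; ring
  have h1 := intervalIntegrable_cpow_mul_crossKernel d (s := s) (by rw [hre]; norm_num)
  rw [intervalIntegrable_iff_integrableOn_Ioc_of_le zero_le_one] at h1
  have hset : Set.Ioi (0 : ℝ) ∩ Set.Iic 1 = Set.Ioc 0 1 := rfl
  have hind : (fun u : ℝ => (u : ℂ) ^ (s - 1) * ((Set.Iic 1).indicator (crossKernel d) u : ℝ)) =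
      (Set.Iic 1).indicator (fun u : ℝ => (u : ℂ) ^ (s - 1) * (crossKernel d u : ℂ)) := by
    ext u
    by_cases hu : u ∈ Set.Iic (1 : ℝ) <;> simp [hu]
  have h2 : MeasureTheory.IntegrableOn
      (fun u : ℝ => (u : ℂ) ^ (s - 1) * ((Set.Iic 1).indicator (crossKernel d) u : ℝ))
      (Set.Ioi 0) := by
    rw [hind, MeasureTheory.IntegrableOn, MeasureTheory.integrable_indicator_iff measurableSet_Iic,
      MeasureTheory.IntegrableOn, MeasureTheory.Measure.restrict_restrict measurableSet_Iic,
      Set.inter_comm, hset]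
    exact h1
  have h3 : MeasureTheory.IntegrableOn
      (fun u : ℝ => (u : ℂ) ^ (s - 1) * (Real.exp (-((2 * d + 1) * u)) : ℝ)) (Set.Ioi 0) := by
    refine ((integrableOn_rpow_mul_exp_neg (a := 1 / 2) (by norm_num) hn).mono' ?_ ?_)
    · refine ContinuousOn.aestronglyMeasurable (fun u hu => ?_) measurableSet_Ioi
      refine ContinuousAt.continuousWithinAt (ContinuousAt.mul
        (Complex.continuousAt_ofReal_cpow_const _ _ (Or.inr (ne_of_gt hu))) (by fun_prop))
    · filter_upwards [MeasureTheory.ae_restrict_mem measurableSet_Ioi] with u hu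
      rw [norm_mul, Complex.norm_cpow_eq_rpow_re_of_pos hu, Complex.norm_real,
        Real.norm_of_nonneg (Real.exp_pos _).le, Complex.sub_re, hre, Complex.one_re]
  have hker : (fun u : ℝ => (u : ℂ) ^ (s - 1) * (kernelError d u : ℂ)) = fun u : ℝ =>
      (u : ℂ) ^ (s - 1) * ((Set.Iic 1).indicator (crossKernel d) u : ℝ) -
        (u : ℂ) ^ (s - 1) * (Real.exp (-((2 * d + 1) * u)) : ℝ) := by
    ext u
    rw [kernelError, Complex.ofReal_sub, mul_sub]
  rw [hker]
  refine ⟨h2.sub h3, ?_⟩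
  rw [MeasureTheory.integral_sub h2 h3, curveError]
  congr 1
  · rw [hind, MeasureTheory.setIntegral_indicator measurableSet_Iic, hset, crossIntegral,
      intervalIntegral.integral_of_le zero_le_one]
  · have := Complex.integral_cpow_mul_exp_neg_mul_Ioi (a := s) (r := (2 * d + 1 : ℝ))
      (by rw [hre]; norm_num) hn
    rw [gammaCurve, hnc, ← hs, show (-(1 / 2 : ℂ) - Complex.I * τ) = -s by rw [hs]; ring,
      Complex.cpow_neg, ← Complex.inv_cpow _ _ (by
        rw [Complex.arg_ofReal_of_nonneg hn.le]
        exact Real.pi_pos.ne), ← one_div, ← this]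
    refine MeasureTheory.setIntegral_congr_fun measurableSet_Ioi fun u _ => ?_
    simp

/-- Varying `τ` in `u^(iτ)` brings out a factor `log u`. Trading it for powers of `u` keeps the
error integrals of Gamma type and costs only `1/10` in the exponent of `2d + 1`, namely `12/5` in
place of `5/2`. -/
theorem abs_log_le {u : ℝ} (hu : 0 < u) : |Real.log u| ≤ 10 * u ^ (-(1 / 10) : ℝ) + u := by
  rcases le_total u 1 with h | h
  · have h1 := Real.abs_log_mul_self_rpow_lt u (1 / 10) hu h (by norm_num)
    rw [abs_mul, abs_of_pos (Real.rpow_pos_of_pos hu _)] at h1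
    have h2 : |Real.log u| ≤ 10 * u ^ (-(1 / 10) : ℝ) := by
      rw [Real.rpow_neg hu.le, ← div_eq_mul_inv, le_div_iff₀ (Real.rpow_pos_of_pos hu _)]
      linarith
    linarith
  · rw [abs_of_nonneg (Real.log_nonneg h)]
    have h1 := Real.log_le_sub_one_of_pos hu
    have h2 := Real.rpow_pos_of_pos hu (-(1 / 10))
    linarith

theorem integral_rpow_mul_kernelBound {a r : ℝ} (ha : 0 < a) (hr : 0 < r) :
    MeasureTheory.IntegrableOn
      (fun u : ℝ => u ^ (a - 1) * ((u ^ 2 + r * u ^ 3) * Real.exp (-(r * u)))) (Set.Ioi 0) ∧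
    ∫ u in Set.Ioi (0 : ℝ), u ^ (a - 1) * ((u ^ 2 + r * u ^ 3) * Real.exp (-(r * u))) =
      (Real.Gamma (a + 2) + Real.Gamma (a + 3)) * r ^ (-(a + 2)) := by
  have i2 := integrableOn_rpow_mul_exp_neg (a := a + 2) (by linarith) hr
  have i3 := (integrableOn_rpow_mul_exp_neg (a := a + 3) (by linarith) hr).const_mul r
  have heq : Set.EqOn (fun u : ℝ => u ^ (a - 1) * ((u ^ 2 + r * u ^ 3) * Real.exp (-(r * u))))
      (fun u => u ^ (a + 2 - 1) * Real.exp (-(r * u)) +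
        r * (u ^ (a + 3 - 1) * Real.exp (-(r * u)))) (Set.Ioi 0) := by
    intro u hu
    have e2 : u ^ (a + 2 - 1) = u ^ (a - 1) * u ^ 2 := by
      rw [← Real.rpow_natCast u 2, ← Real.rpow_add hu]
      congr 1
      push_cast
      ring
    have e3 : u ^ (a + 3 - 1) = u ^ (a - 1) * u ^ 3 := by
      rw [← Real.rpow_natCast u 3, ← Real.rpow_add hu]
      congr 1
      push_cast
      ring
    simp only [e2, e3]
    ring
  refine ⟨(MeasureTheory.integrableOn_congr_fun heq measurableSet_Ioi).2 (i2.add i3), ?_⟩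
  rw [MeasureTheory.setIntegral_congr_fun measurableSet_Ioi heq, MeasureTheory.integral_add i2 i3,
    MeasureTheory.integral_const_mul, Real.integral_rpow_mul_exp_neg_mul_Ioi (by linarith) hr,
    Real.integral_rpow_mul_exp_neg_mul_Ioi (by linarith) hr, one_div,
    Real.inv_rpow hr.le, Real.inv_rpow hr.le, ← Real.rpow_neg hr.le, ← Real.rpow_neg hr.le,
    show -(a + 2) = 1 + -(a + 3) by ring, Real.rpow_add hr, Real.rpow_one]
  ring

theorem norm_cpow_sub_cpow_le {u : ℝ} (hu : 0 < u) (σ τ : ℝ) :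
    ‖(u : ℂ) ^ (1 / 2 + Complex.I * σ - 1) - (u : ℂ) ^ (1 / 2 + Complex.I * τ - 1)‖ ≤
      u ^ (1 / 2 - 1 : ℝ) * (|Real.log u| * |σ - τ|) := by
  have hu0 : (u : ℂ) ≠ 0 := by exact_mod_cast hu.ne'
  have h : (u : ℂ) ^ (1 / 2 + Complex.I * σ - 1) - (u : ℂ) ^ (1 / 2 + Complex.I * τ - 1) =
      (u : ℂ) ^ (1 / 2 + Complex.I * τ - 1) *
        (Complex.exp (Complex.I * (Real.log u * (σ - τ) : ℝ)) - 1) := by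
    rw [mul_sub, mul_one, show (1 / 2 + Complex.I * σ - 1 : ℂ) =
      (1 / 2 + Complex.I * τ - 1) + Complex.I * (σ - τ) by ring, Complex.cpow_add _ _ hu0,
      Complex.cpow_def_of_ne_zero hu0 (Complex.I * (σ - τ)), ← Complex.ofReal_log hu.le]
    push_cast
    ring_nf
  rw [h, norm_mul, Complex.norm_cpow_eq_rpow_re_of_pos hu, ← abs_mul]
  simp only [Complex.sub_re, Complex.add_re, Complex.mul_re, Complex.I_re, Complex.I_im,
    Complex.ofReal_im, Complex.one_re]
  norm_num
  gcongr
  have := Real.norm_exp_I_mul_ofReal_sub_one_le (x := Real.log u * (σ - τ))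
  simpa [abs_mul] using this

theorem exists_curveError_bound : ∃ C : ℝ, 0 < C ∧ ∀ d : ℕ, ∀ σ τ : ℝ,
    ‖curveError d τ‖ ≤ C * (2 * d + 1 : ℝ) ^ (-(5 / 2) : ℝ) ∧
    ‖curveError d σ - curveError d τ‖ ≤ C * (2 * d + 1 : ℝ) ^ (-(12 / 5) : ℝ) * |σ - τ| := by
  set A : ℝ := Real.Gamma (1 / 2 + 2) + Real.Gamma (1 / 2 + 3) with hA
  set B : ℝ := Real.Gamma (2 / 5 + 2) + Real.Gamma (2 / 5 + 3) with hB
  set E : ℝ := Real.Gamma (3 / 2 + 2) + Real.Gamma (3 / 2 + 3) with hE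
  have hA0 : 0 < A := add_pos (Real.Gamma_pos_of_pos (by norm_num)) (Real.Gamma_pos_of_pos (by norm_num))
  have hB0 : 0 < B := add_pos (Real.Gamma_pos_of_pos (by norm_num)) (Real.Gamma_pos_of_pos (by norm_num))
  have hE0 : 0 < E := add_pos (Real.Gamma_pos_of_pos (by norm_num)) (Real.Gamma_pos_of_pos (by norm_num))
  refine ⟨A + 10 * B + E, by positivity, fun d σ τ => ?_⟩
  have hn : (0 : ℝ) < 2 * d + 1 := by positivity
  set n : ℝ := 2 * d + 1 with hndef
  have hn1 : 1 ≤ n := by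
    have : (0 : ℝ) ≤ d := Nat.cast_nonneg d
    linarith
  obtain ⟨iA, eA⟩ := integral_rpow_mul_kernelBound (a := 1 / 2) (by norm_num) hn
  obtain ⟨iB, eB⟩ := integral_rpow_mul_kernelBound (a := 2 / 5) (by norm_num) hn
  obtain ⟨iE, eE⟩ := integral_rpow_mul_kernelBound (a := 3 / 2) (by norm_num) hn
  obtain ⟨iσ, eσ⟩ := curveError_eq d σ
  obtain ⟨iτ, eτ⟩ := curveError_eq d τ
  constructor
  · have h : ‖curveError d τ‖ ≤ A * n ^ (-(1 / 2 + 2) : ℝ) := by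
      rw [eτ, ← eA]
      refine MeasureTheory.norm_integral_le_of_norm_le iA ?_
      filter_upwards [MeasureTheory.ae_restrict_mem measurableSet_Ioi] with u hu
      have hu0 : 0 < u := hu
      rw [norm_mul, Complex.norm_cpow_eq_rpow_re_of_pos hu, Complex.norm_real, Real.norm_eq_abs]
      have hre : (1 / 2 + Complex.I * τ - 1 : ℂ).re = 1 / 2 - 1 := by simp
      rw [hre]
      gcongr
      exact abs_kernelError_le d hu0.le
    refine h.trans ?_
    rw [show (-(1 / 2 + 2) : ℝ) = -(5 / 2) by norm_num]
    gcongr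
    linarith
  · have h : ‖curveError d σ - curveError d τ‖ ≤
        10 * |σ - τ| * (B * n ^ (-(2 / 5 + 2) : ℝ)) + |σ - τ| * (E * n ^ (-(3 / 2 + 2) : ℝ)) := by
      rw [eσ, eτ, ← eB, ← eE, ← MeasureTheory.integral_sub iσ iτ,
        ← MeasureTheory.integral_const_mul, ← MeasureTheory.integral_const_mul,
        ← MeasureTheory.integral_add (iB.const_mul _) (iE.const_mul _)]
      refine MeasureTheory.norm_integral_le_of_norm_le ((iB.const_mul _).add (iE.const_mul _)) ?_
      filter_upwards [MeasureTheory.ae_restrict_mem measurableSet_Ioi] with u hu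
      have hu0 : 0 < u := hu
      rw [← sub_mul, norm_mul, Complex.norm_real, Real.norm_eq_abs]
      have h1 := norm_cpow_sub_cpow_le hu0 σ τ
      have h2 := abs_kernelError_le d hu0.le
      have h3 := abs_log_le hu0
      have e1 : u ^ (2 / 5 - 1 : ℝ) = u ^ (1 / 2 - 1 : ℝ) * u ^ (-(1 / 10) : ℝ) := by
        rw [← Real.rpow_add hu0]
        norm_num
      have e2 : u ^ (3 / 2 - 1 : ℝ) = u ^ (1 / 2 - 1 : ℝ) * u := by
        rw [← Real.rpow_add_one hu0.ne']
        norm_num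
      have hp : 0 < u ^ (1 / 2 - 1 : ℝ) := Real.rpow_pos_of_pos hu0 _
      refine (mul_le_mul h1 h2 (abs_nonneg _) (by positivity)).trans ?_
      rw [e1, e2]
      have hb : 0 ≤ (u ^ 2 + n * u ^ 3) * Real.exp (-(n * u)) := by positivity
      calc _ ≤ u ^ (1 / 2 - 1 : ℝ) * ((10 * u ^ (-(1 / 10) : ℝ) + u) * |σ - τ|) *
            ((u ^ 2 + n * u ^ 3) * Real.exp (-(n * u))) := by gcongr
        _ = _ := by ring
    have hle : n ^ (-(3 / 2 + 2) : ℝ) ≤ n ^ (-(12 / 5) : ℝ) :=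
      Real.rpow_le_rpow_of_exponent_le hn1 (by norm_num)
    refine h.trans ?_
    rw [show (-(2 / 5 + 2) : ℝ) = -(12 / 5) by norm_num]
    have hp : 0 < n ^ (-(12 / 5) : ℝ) := Real.rpow_pos_of_pos hn _
    have := abs_nonneg (σ - τ)
    calc _ ≤ 10 * |σ - τ| * (B * n ^ (-(12 / 5) : ℝ)) + |σ - τ| * (E * n ^ (-(12 / 5) : ℝ)) := by
          gcongr
      _ = (10 * B + E) * n ^ (-(12 / 5) : ℝ) * |σ - τ| := by ring
      _ ≤ _ := by
          gcongr
          linarith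

/-! ### Relative error and the phase of the integral -/

theorem gammaArg_sub (d : ℕ) {T a b : ℝ} (ha : -T ≤ a) (hab : a ≤ b) (hb : b ≤ T) :
    (Real.log (2 * d + 1) - Real.log (2 * T + 2)) * (b - a) ≤ gammaArg d a - gammaArg d b ∧
      gammaArg d a - gammaArg d b ≤ (Real.log (2 * d + 1) + 3) * (b - a) := by
  obtain ⟨F, hF, h⟩ := exists_arg_Gamma
  have := hF T a b ha hab hb
  rw [h, h]
  constructor <;> linarith

theorem abs_gammaArg_sub_le (d : ℕ) {T σ τ : ℝ} (hσ : |σ| ≤ T) (hτ : |τ| ≤ T) :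
    |gammaArg d σ - gammaArg d τ| ≤
      (Real.log (2 * d + 1) + Real.log (2 * T + 2) + 3) * |σ - τ| := by
  have hT : 0 ≤ T := (abs_nonneg _).trans hσ
  have h1 : 0 ≤ Real.log (2 * d + 1) :=
    Real.log_nonneg (by linarith [(Nat.cast_nonneg d : (0 : ℝ) ≤ d)])
  have h2 : 0 ≤ Real.log (2 * T + 2) := Real.log_nonneg (by linarith)
  rw [abs_le] at hσ hτ ⊢
  rcases le_total σ τ with h | h
  · have := gammaArg_sub d hσ.1 h hτ.2
    rw [abs_of_nonpos (by linarith : σ - τ ≤ 0)]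
    constructor <;> nlinarith
  · have := gammaArg_sub d hτ.1 h hσ.2
    rw [abs_of_nonneg (by linarith : 0 ≤ σ - τ)]
    constructor <;> nlinarith

/-- This is the reflection formula at `s = 1/2 + iτ`, where `1 - s` is the conjugate of `s` and
`sin(πs) = cosh(πτ)`. -/
theorem norm_Gamma_half_add_sq (τ : ℝ) :
    ‖Complex.Gamma (1 / 2 + Complex.I * τ)‖ ^ 2 = Real.pi / Real.cosh (Real.pi * τ) := by
  set s : ℂ := 1 / 2 + Complex.I * τ with hs
  have hconj : (starRingEnd ℂ) s = 1 - s := by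
    simp [hs, Complex.ext_iff]
    norm_num
  have h1 := Complex.Gamma_mul_Gamma_one_sub s
  rw [← hconj, Complex.Gamma_conj, Complex.mul_conj, Complex.normSq_eq_norm_sq,
    show (Real.pi : ℂ) * s = (Real.pi * τ : ℂ) * Complex.I + Real.pi / 2 by rw [hs]; ring,
    Complex.sin_add_pi_div_two, Complex.cos_mul_I] at h1
  exact_mod_cast h1

/-- The reciprocal of `‖gammaCurve d τ‖`. -/
noncomputable def invNormCurve (d : ℕ) (τ : ℝ) : ℝ :=
  √(2 * d + 1) * √(Real.cosh (Real.pi * τ) / Real.pi)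

theorem invNormCurve_mul_norm (d : ℕ) (τ : ℝ) : invNormCurve d τ * ‖gammaCurve d τ‖ = 1 := by
  have hn : (0 : ℝ) < 2 * d + 1 := by positivity
  have hnc : (2 * (d : ℂ) + 1) = ((2 * d + 1 : ℝ) : ℂ) := by push_cast; ring
  have hc := Real.cosh_pos (Real.pi * τ)
  have hΓ : ‖Complex.Gamma (1 / 2 + Complex.I * τ)‖ = √(Real.pi / Real.cosh (Real.pi * τ)) := by
    rw [← norm_Gamma_half_add_sq, Real.sqrt_sq (norm_nonneg _)]
  have h1 : √(2 * d + 1 : ℝ) * (2 * d + 1 : ℝ) ^ (-(1 / 2) : ℝ) = 1 := by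
    rw [Real.sqrt_eq_rpow, ← Real.rpow_add hn]
    norm_num
  have h2 : √(Real.cosh (Real.pi * τ) / Real.pi) * √(Real.pi / Real.cosh (Real.pi * τ)) = 1 := by
    rw [← Real.sqrt_mul (by positivity)]
    field_simp
    simp
  have hre : (-(1 / 2 : ℂ) - Complex.I * τ).re = -(1 / 2) := by simp
  rw [invNormCurve, gammaCurve, norm_mul, hΓ, hnc, Complex.norm_cpow_eq_rpow_re_of_pos hn, hre]
  linear_combination √(Real.cosh (Real.pi * τ) / Real.pi) *
    √(Real.pi / Real.cosh (Real.pi * τ)) * h1 + h2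

theorem invNormCurve_le (d : ℕ) {T τ : ℝ} (hτ : |τ| ≤ T) :
    invNormCurve d τ ≤ √(2 * d + 1) * Real.exp (Real.pi * T / 2) := by
  refine mul_le_mul_of_nonneg_left ?_ (Real.sqrt_nonneg _)
  have hp := Real.pi_gt_three
  have h1 : Real.cosh (Real.pi * τ) ≤ Real.exp (Real.pi * T) := by
    rw [Real.cosh_eq]
    have a1 : Real.exp (Real.pi * τ) ≤ Real.exp (Real.pi * T) := by
      gcongr
      exact (abs_le.1 hτ).2
    have a2 : Real.exp (-(Real.pi * τ)) ≤ Real.exp (Real.pi * T) := by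
      refine Real.exp_le_exp.2 ?_
      nlinarith [(abs_le.1 hτ).1]
    linarith
  rw [Real.sqrt_le_left (Real.exp_pos _).le, ← Real.exp_nat_mul]
  have e : ((2 : ℕ) : ℝ) * (Real.pi * T / 2) = Real.pi * T := by push_cast; ring
  rw [e]
  exact (div_le_self (Real.cosh_pos _).le (by linarith)).trans h1

/-- Because `|sinh| ≤ cosh` and `π < 4`, the derivative of `invNormCurve` is at most twice the
function. -/
theorem abs_invNormCurve_sub_le (d : ℕ) {T σ τ : ℝ} (hσ : |σ| ≤ T) (hτ : |τ| ≤ T) :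
    |invNormCurve d σ - invNormCurve d τ| ≤
      2 * (√(2 * d + 1) * Real.exp (Real.pi * T / 2)) * |σ - τ| := by
  have hp := Real.pi_gt_three
  have hp4 := Real.pi_lt_four
  have hd : ∀ x : ℝ, HasDerivAt (invNormCurve d) (√(2 * d + 1) *
      (Real.sinh (Real.pi * x) / (2 * √(Real.cosh (Real.pi * x) / Real.pi)))) x := by
    intro x
    have hc := Real.cosh_pos (Real.pi * x)
    refine (((((hasDerivAt_id x).const_mul Real.pi).cosh.div_const Real.pi).sqrt
      (by positivity)).const_mul (√(2 * d + 1))).congr_deriv ?_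
    simp only [id]
    field_simp
  have := (convex_Icc (-T) T).norm_image_sub_le_of_norm_hasDerivWithin_le (f := invNormCurve d)
    (C := 2 * (√(2 * d + 1) * Real.exp (Real.pi * T / 2)))
    (fun x _ => (hd x).hasDerivWithinAt) (fun x hx => ?_) (abs_le.1 hτ) (abs_le.1 hσ)
  · simpa [Real.norm_eq_abs] using this
  · have hle := invNormCurve_le d (abs_le.2 hx)
    have hc := Real.cosh_pos (Real.pi * x)
    set y := √(Real.cosh (Real.pi * x) / Real.pi) with hy
    have hy0 : 0 < y := Real.sqrt_pos.2 (by positivity)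
    have hyy : y * y = Real.cosh (Real.pi * x) / Real.pi := Real.mul_self_sqrt (by positivity)
    have hs : |Real.sinh (Real.pi * x)| ≤ Real.cosh (Real.pi * x) := by
      rw [← abs_of_pos hc]
      refine sq_le_sq.1 ?_
      linarith [Real.cosh_sq (Real.pi * x)]
    have h1 : |Real.sinh (Real.pi * x)| / (2 * y) ≤ 2 * y := by
      rw [div_le_iff₀ (by positivity)]
      have : Real.cosh (Real.pi * x) = Real.pi * (y * y) := by
        rw [hyy]
        field_simp
      nlinarith [mul_pos hy0 hy0]
    rw [Real.norm_eq_abs, abs_mul, abs_of_nonneg (Real.sqrt_nonneg _), abs_div,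
      abs_of_pos (by positivity : 0 < 2 * y)]
    calc _ ≤ √(2 * d + 1 : ℝ) * (2 * y) := by gcongr
      _ = 2 * invNormCurve d x := by rw [invNormCurve, ← hy]; ring
      _ ≤ _ := by linarith

/-- The relative error of the approximation of the integral by `gammaCurve`. -/
noncomputable def relError (d : ℕ) (τ : ℝ) : ℂ :=
  Complex.exp (-(Complex.I * gammaArg d τ)) * curveError d τ * invNormCurve d τ

theorem crossIntegral_eq_mul (d : ℕ) (τ : ℝ) :
    crossIntegral d (1 / 2 + Complex.I * τ) = gammaCurve d τ * (1 + relError d τ) := by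
  have h1 := (gammaArg_spec d).2.2 τ
  have h2 : (invNormCurve d τ : ℂ) * ‖gammaCurve d τ‖ = 1 := by
    exact_mod_cast invNormCurve_mul_norm d τ
  have h3 : Complex.exp (Complex.I * gammaArg d τ) * Complex.exp (-(Complex.I * gammaArg d τ)) = 1 := by
    rw [← Complex.exp_add, add_neg_cancel, Complex.exp_zero]
  have h4 : gammaCurve d τ * relError d τ = curveError d τ := by
    rw [relError, h1]
    rw [h1, norm_mul, Complex.norm_real, norm_norm, mul_comm Complex.I, Complex.norm_exp_ofReal_mul_I,
      mul_one] at h2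
    simp only [mul_comm Complex.I _] at h2 h3 ⊢
    linear_combination curveError d τ * h2 +
      (curveError d τ * ‖gammaCurve d τ‖ * invNormCurve d τ) * h3
  rw [mul_add, mul_one, h4, curveError]
  ring

theorem norm_exp_neg_I_mul_sub_le (x y : ℝ) :
    ‖Complex.exp (-(Complex.I * x)) - Complex.exp (-(Complex.I * y))‖ ≤ |x - y| := by
  have h : Complex.exp (-(Complex.I * x)) - Complex.exp (-(Complex.I * y)) =
      Complex.exp ((-y : ℝ) * Complex.I) * (Complex.exp (Complex.I * (y - x : ℝ)) - 1) := by
    rw [mul_sub, ← Complex.exp_add, mul_one]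
    push_cast
    ring_nf
  rw [h, norm_mul, Complex.norm_exp_ofReal_mul_I, one_mul, abs_sub_comm]
  exact Real.norm_exp_I_mul_ofReal_sub_one_le

/-- Each of the three factors of `relError` is bounded and Lipschitz. The exponent is `-12/5 + 1/2 =
-19/10`. The constant `6` is `3 + 1 + 2`, from `gammaArg`, `curveError` and `invNormCurve`. -/
theorem exists_relError_bound : ∃ C : ℝ, 0 < C ∧ ∀ d : ℕ, ∀ T σ τ : ℝ, |σ| ≤ T → |τ| ≤ T →
    ‖relError d τ‖ ≤ C * (2 * d + 1 : ℝ) ^ (-(19 / 10) : ℝ) * Real.exp (Real.pi * T / 2) ∧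
    ‖relError d σ - relError d τ‖ ≤ C * (2 * d + 1 : ℝ) ^ (-(19 / 10) : ℝ) *
      Real.exp (Real.pi * T / 2) *
        (Real.log (2 * d + 1) + Real.log (2 * T + 2) + 6) * |σ - τ| := by
  obtain ⟨C, hC, h⟩ := exists_curveError_bound
  refine ⟨C, hC, fun d T σ τ hσ hτ => ?_⟩
  have hn : (0 : ℝ) < 2 * d + 1 := by positivity
  have hφ := abs_gammaArg_sub_le d hσ hτ
  have hM := abs_invNormCurve_sub_le d hσ hτ
  have hMσ := invNormCurve_le d hσ
  have hMτ := invNormCurve_le d hτ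
  obtain ⟨hΔ, hΔL⟩ := h d σ τ
  have hn1 : (1 : ℝ) ≤ 2 * d + 1 := by linarith [(Nat.cast_nonneg d : (0 : ℝ) ≤ d)]
  set n : ℝ := 2 * d + 1 with hndef
  set X := Real.exp (Real.pi * T / 2) with hX
  have hX0 : 0 < X := Real.exp_pos _
  set p : ℝ := n ^ (-(19 / 10) : ℝ) with hp
  have hp0 : 0 < p := Real.rpow_pos_of_pos hn _
  have e1 : n ^ (-(12 / 5) : ℝ) * √n = p := by
    rw [Real.sqrt_eq_rpow, ← Real.rpow_add hn, hp]
    norm_num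
  have hΔ' : ‖curveError d τ‖ ≤ C * n ^ (-(12 / 5) : ℝ) := by
    refine hΔ.trans ?_
    have := Real.rpow_le_rpow_of_exponent_le hn1 (by norm_num : (-(5 / 2) : ℝ) ≤ -(12 / 5))
    gcongr
  have hM0 : ∀ x, 0 ≤ invNormCurve d x := fun x =>
    mul_nonneg (Real.sqrt_nonneg _) (Real.sqrt_nonneg _)
  have hexp : ∀ x : ℝ, ‖Complex.exp (-(Complex.I * x))‖ = 1 := fun x => by
    rw [show -(Complex.I * x) = ((-x : ℝ) : ℂ) * Complex.I by push_cast; ring,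
      Complex.norm_exp_ofReal_mul_I]
  have hnM : ∀ x, ‖(invNormCurve d x : ℂ)‖ = invNormCurve d x := fun x => by
    rw [Complex.norm_real, Real.norm_of_nonneg (hM0 x)]
  have hq0 : 0 < n ^ (-(12 / 5) : ℝ) := Real.rpow_pos_of_pos hn _
  have hs0 : 0 ≤ √n := Real.sqrt_nonneg _
  have hL : 0 ≤ Real.log n + Real.log (2 * T + 2) + 3 := by
    have h1 : 0 ≤ Real.log n := Real.log_nonneg hn1
    have h2 : 0 ≤ Real.log (2 * T + 2) :=
      Real.log_nonneg (by linarith [(abs_nonneg σ).trans hσ])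
    linarith
  constructor
  · rw [relError, norm_mul, norm_mul, hexp, one_mul, hnM]
    calc _ ≤ (C * n ^ (-(12 / 5) : ℝ)) * (√n * X) :=
          mul_le_mul hΔ' hMτ (hM0 τ) (by positivity)
      _ = _ := by rw [← e1]; ring
  · have hdec : relError d σ - relError d τ =
        (Complex.exp (-(Complex.I * gammaArg d σ)) - Complex.exp (-(Complex.I * gammaArg d τ))) *
          curveError d τ * invNormCurve d σ +
        Complex.exp (-(Complex.I * gammaArg d σ)) * (curveError d σ - curveError d τ) *
          invNormCurve d σ +
        Complex.exp (-(Complex.I * gammaArg d τ)) * curveError d τ *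
          ((invNormCurve d σ - invNormCurve d τ : ℝ) : ℂ) := by
      rw [relError, relError]
      push_cast
      ring
    have b1 : ‖(Complex.exp (-(Complex.I * gammaArg d σ)) -
        Complex.exp (-(Complex.I * gammaArg d τ))) * curveError d τ * invNormCurve d σ‖ ≤
        ((Real.log n + Real.log (2 * T + 2) + 3) * |σ - τ|) * (C * n ^ (-(12 / 5) : ℝ)) *
          (√n * X) := by
      rw [norm_mul, norm_mul, hnM]
      have := (norm_exp_neg_I_mul_sub_le (gammaArg d σ) (gammaArg d τ)).trans hφ
      have := hM0 σ
      gcongr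
    have b2 : ‖Complex.exp (-(Complex.I * gammaArg d σ)) * (curveError d σ - curveError d τ) *
        invNormCurve d σ‖ ≤ (C * n ^ (-(12 / 5) : ℝ) * |σ - τ|) * (√n * X) := by
      rw [norm_mul, norm_mul, hnM, hexp, one_mul]
      have := hM0 σ
      gcongr
    have b3 : ‖Complex.exp (-(Complex.I * gammaArg d τ)) * curveError d τ *
        ((invNormCurve d σ - invNormCurve d τ : ℝ) : ℂ)‖ ≤
        (C * n ^ (-(12 / 5) : ℝ)) * (2 * (√n * X) * |σ - τ|) := by
      rw [norm_mul, norm_mul, hexp, one_mul, Complex.norm_real, Real.norm_eq_abs]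
      gcongr
    rw [hdec]
    refine ((norm_add₃_le).trans (add_le_add (add_le_add b1 b2) b3)).trans (le_of_eq ?_)
    rw [← e1]
    ring

theorem norm_log_one_add_sub_le {z w : ℂ} (hz : ‖z‖ ≤ 1 / 2) (hw : ‖w‖ ≤ 1 / 2) :
    ‖Complex.log (1 + z) - Complex.log (1 + w)‖ ≤ 2 * ‖z - w‖ := by
  have hre : ∀ x ∈ Metric.closedBall (0 : ℂ) (1 / 2), 1 / 2 ≤ (1 + x).re := fun x hx => by
    have h1 := mem_closedBall_zero_iff.1 hx
    have h2 := (abs_le.1 (Complex.abs_re_le_norm x)).1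
    rw [Complex.add_re, Complex.one_re]
    linarith
  refine (convex_closedBall (0 : ℂ) (1 / 2)).norm_image_sub_le_of_norm_hasDerivWithin_le
    (f := fun z => Complex.log (1 + z)) (f' := fun z => 1 / (1 + z)) (C := 2) (fun x hx => ?_)
    (fun x hx => ?_) (mem_closedBall_zero_iff.2 hw) (mem_closedBall_zero_iff.2 hz)
  · exact (((hasDerivAt_id x).const_add 1).clog (Or.inl
      (lt_of_lt_of_le (by norm_num) (hre x hx)))).hasDerivWithinAt
  · rw [norm_div, norm_one]
    have h1 := (hre x hx).trans (Complex.re_le_norm (1 + x))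
    rw [div_le_iff₀ (by linarith)]
    linarith

/-- The growth rate of the errors on `[-(log d + 1), log d + 1]` tends to zero. -/
theorem tendsto_relError_rate {C : ℝ} (hC : 0 < C) :
    Tendsto (fun d : ℕ => C * (2 * d + 1 : ℝ) ^ (-(19 / 10) : ℝ) *
      Real.exp (Real.pi * (Real.log d + 1) / 2) *
        (Real.log (2 * d + 1) + Real.log (2 * (Real.log d + 1) + 2) + 6)) atTop (𝓝 0) := by
  have hn : Tendsto (fun d : ℕ => (2 * d + 1 : ℝ)) atTop atTop :=
    tendsto_atTop_add_const_right _ _ (tendsto_natCast_atTop_atTop.const_mul_atTop two_pos)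
  have h1 : Tendsto (fun x : ℝ => Real.log x / x ^ (3 / 10 : ℝ)) atTop (𝓝 0) :=
    (isLittleO_log_rpow_atTop (by norm_num)).tendsto_div_nhds_zero
  have h2 : Tendsto (fun x : ℝ => x ^ (-(3 / 10) : ℝ)) atTop (𝓝 0) :=
    tendsto_rpow_neg_atTop (by norm_num)
  have h3 : Tendsto (fun x : ℝ => C * Real.exp (8 / 5) *
      (3 * (Real.log x / x ^ (3 / 10 : ℝ)) + 9 * x ^ (-(3 / 10) : ℝ))) atTop (𝓝 0) := by
    simpa using ((h1.const_mul 3).add (h2.const_mul 9)).const_mul (C * Real.exp (8 / 5))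
  refine squeeze_zero' ?_ ?_ (h3.comp hn)
  · filter_upwards with d
    have h4 : 0 ≤ Real.log (2 * (d : ℝ) + 1) :=
      Real.log_nonneg (by linarith [(Nat.cast_nonneg d : (0 : ℝ) ≤ d)])
    have h5 : 0 ≤ Real.log (2 * (Real.log d + 1) + 2) :=
      Real.log_nonneg (by linarith [Real.log_natCast_nonneg d])
    positivity
  · filter_upwards [eventually_ge_atTop 1] with d hd
    have hd1 : (1 : ℝ) ≤ d := by exact_mod_cast hd
    have hlog : Real.log d ≤ Real.log (2 * d + 1) := Real.log_le_log (by linarith) (by linarith)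
    have hlog0 : 0 ≤ Real.log d := Real.log_natCast_nonneg d
    simp only [Function.comp_apply]
    have hx : (0 : ℝ) < 2 * d + 1 := by positivity
    set x : ℝ := 2 * d + 1 with hxdef
    -- Any exponent between `π/2` and `19/10` would do; `8/5` leaves the decay `x^(-3/10)`, which
    -- beats the logarithms.
    have e1 : Real.exp (Real.pi * (Real.log d + 1) / 2) ≤ Real.exp (8 / 5) * x ^ (8 / 5 : ℝ) := by
      rw [Real.rpow_def_of_pos hx, ← Real.exp_add]
      refine Real.exp_le_exp.2 ?_
      nlinarith [Real.pi_lt_d2]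
    have e2 : Real.log (2 * (Real.log d + 1) + 2) ≤ 2 * Real.log x + 3 := by
      refine (Real.log_le_sub_one_of_pos (by positivity)).trans ?_
      linarith
    have e3 : x ^ (-(19 / 10) : ℝ) * x ^ (8 / 5 : ℝ) = x ^ (-(3 / 10) : ℝ) := by
      rw [← Real.rpow_add hx]
      norm_num
    have h5 : 0 ≤ Real.log (2 * (Real.log d + 1) + 2) := Real.log_nonneg (by linarith)
    calc _ ≤ C * x ^ (-(19 / 10) : ℝ) * (Real.exp (8 / 5) * x ^ (8 / 5 : ℝ)) *
          (3 * Real.log x + 9) := by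
          refine mul_le_mul (by gcongr) (by linarith) ?_ (by positivity)
          linarith
      _ = C * Real.exp (8 / 5) * ((3 * Real.log x + 9) *
            (x ^ (-(19 / 10) : ℝ) * x ^ (8 / 5 : ℝ))) := by ring
      _ = _ := by
          rw [e3, Real.rpow_neg hx.le]
          ring

/-- Uniformly for `|τ| ≤ log d + 1`, the argument of the integral is a small Lipschitz
perturbation of `gammaArg`. -/
theorem exists_phase {η : ℝ} (hη : 0 < η) : ∀ᶠ d : ℕ in atTop, ∃ θ : ℝ → ℝ,
    (∀ τ, |τ| ≤ Real.log d + 1 → |θ τ| ≤ η ∧ ∃ r : ℝ, 0 < r ∧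
      crossIntegral d (1 / 2 + Complex.I * τ) =
        r * Complex.exp (Complex.I * (gammaArg d τ + θ τ : ℝ))) ∧
    ∀ σ τ, |σ| ≤ Real.log d + 1 → |τ| ≤ Real.log d + 1 → |θ σ - θ τ| ≤ η * |σ - τ| := by
  obtain ⟨C, hC, h⟩ := exists_relError_bound
  -- The bound `1/2` keeps `1 + relError` where `norm_log_one_add_sub_le` applies, and `η / 2`
  -- compensates its factor `2`.
  have hη' : 0 < min (1 / 2) (η / 2) := by positivity
  filter_upwards [(tendsto_relError_rate hC).eventually_lt_const hη'] with d hd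
  set T := Real.log d + 1 with hT
  have hT1 : 1 ≤ T := by linarith [Real.log_natCast_nonneg d]
  set A := C * (2 * d + 1 : ℝ) ^ (-(19 / 10) : ℝ) * Real.exp (Real.pi * T / 2) with hA
  have hn : (0 : ℝ) < 2 * d + 1 := by positivity
  have hA0 : 0 ≤ A := by positivity
  have hL : 1 ≤ Real.log (2 * d + 1) + Real.log (2 * T + 2) + 6 := by
    have h1 : 0 ≤ Real.log (2 * d + 1) :=
      Real.log_nonneg (by linarith [(Nat.cast_nonneg d : (0 : ℝ) ≤ d)])
    have h2 : 0 ≤ Real.log (2 * T + 2) := Real.log_nonneg (by linarith)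
    linarith
  have hAL : A ≤ A * (Real.log (2 * d + 1) + Real.log (2 * T + 2) + 6) :=
    le_mul_of_one_le_right hA0 hL
  have hlt := lt_min_iff.1 hd
  have hε : ∀ τ, |τ| ≤ T → ‖relError d τ‖ ≤ 1 / 2 ∧ ‖relError d τ‖ ≤ η / 2 := fun τ hτ => by
    have := (h d T τ τ hτ hτ).1
    constructor <;> linarith [hlt.1, hlt.2]
  refine ⟨fun τ => (Complex.log (1 + relError d τ)).im, fun τ hτ => ⟨?_, ?_⟩, fun σ τ hσ hτ => ?_⟩
  · have h1 := norm_log_one_add_sub_le (hε τ hτ).1 (w := 0) (by simp)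
    rw [add_zero, Complex.log_one, sub_zero, sub_zero] at h1
    linarith [Complex.abs_im_le_norm (Complex.log (1 + relError d τ)), (hε τ hτ).2]
  · have hne : 1 + relError d τ ≠ 0 := fun h0 => by
      have h1 := (hε τ hτ).1
      rw [show relError d τ = -1 by linear_combination h0] at h1
      norm_num at h1
    have hγ : 0 < ‖gammaCurve d τ‖ := by
      have := invNormCurve_mul_norm d τ
      refine lt_of_le_of_ne (norm_nonneg _) fun h0 => ?_
      simp [← h0] at this
    refine ⟨‖gammaCurve d τ‖ * ‖1 + relError d τ‖, mul_pos hγ (norm_pos_iff.2 hne), ?_⟩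
    simp only [Complex.log_im]
    rw [crossIntegral_eq_mul, Complex.ofReal_add, mul_add Complex.I, Complex.exp_add]
    conv_lhs => rw [(gammaArg_spec d).2.2 τ, ← Complex.norm_mul_exp_arg_mul_I (1 + relError d τ)]
    push_cast
    ring_nf
  · have h1 := norm_log_one_add_sub_le (hε σ hσ).1 (hε τ hτ).1
    have h2 := (h d T σ τ hσ hτ).2
    rw [← Complex.sub_im]
    refine (Complex.abs_im_le_norm _).trans (h1.trans ?_)
    have h3 : ‖relError d σ - relError d τ‖ ≤ η / 2 * |σ - τ| :=
      h2.trans (mul_le_mul_of_nonneg_right hlt.2.le (abs_nonneg _))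
    linarith

/-! ### Counting integer values of a monotone phase -/

/-- The number of integers in `[x, y]` differs from `y - x` by at most `1`, and by less if one of
the endpoints is away from the integers. -/
theorem abs_card_Icc_ceil_floor_sub_le {x y : ℝ} (hxy : x ≤ y) {κ : ℝ}
    (h : κ = 0 ∨ 0 < κ ∧ ((∀ k : ℤ, κ ≤ |y - k|) ∨ ∀ k : ℤ, κ ≤ |x - k|)) :
    |((Finset.Icc ⌈x⌉ ⌊y⌋).card : ℝ) - (y - x)| ≤ 1 - κ := by
  have hle : ⌈x⌉ ≤ ⌊y⌋ + 1 := by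
    rw [Int.ceil_le]
    push_cast
    linarith [(Int.lt_floor_add_one y)]
  have hcard : ((Finset.Icc ⌈x⌉ ⌊y⌋).card : ℝ) = ⌊y⌋ + 1 - ⌈x⌉ := by
    have : ((Finset.Icc ⌈x⌉ ⌊y⌋).card : ℤ) = ⌊y⌋ + 1 - ⌈x⌉ := by
      rw [Int.card_Icc, Int.toNat_of_nonneg (by linarith)]
    exact_mod_cast this
  have hy1 := Int.floor_le y
  have hy2 := Int.lt_floor_add_one y
  have hx1 := Int.le_ceil x
  have hx2 := Int.ceil_lt_add_one x
  rw [hcard, abs_le]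
  rcases h with rfl | ⟨hκ, h | h⟩
  · constructor <;> linarith
  · have h1 := h ⌊y⌋
    have h2 := h (⌊y⌋ + 1)
    push_cast at h2
    rw [abs_of_nonneg (by linarith)] at h1
    rw [abs_of_nonpos (by linarith)] at h2
    constructor <;> linarith
  · have h1 := h ⌈x⌉
    have h2 := h (⌈x⌉ - 1)
    push_cast at h2
    rw [abs_of_nonpos (by linarith)] at h1
    rw [abs_of_nonneg (by linarith)] at h2
    constructor <;> linarith

/-- A continuous strictly decreasing function takes integer values as often as there are integers
between its values at the endpoints. -/
theorem ncard_integer_values {Ψ : ℝ → ℝ} {a b : ℝ} (hab : a ≤ b)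
    (hc : ContinuousOn Ψ (Set.Icc a b)) (hanti : StrictAntiOn Ψ (Set.Icc a b)) :
    Set.ncard {τ | τ ∈ Set.Icc a b ∧ ∃ k : ℤ, Ψ τ = k} = (Finset.Icc ⌈Ψ b⌉ ⌊Ψ a⌋).card := by
  rw [← Set.ncard_coe_finset]
  refine Set.ncard_congr (fun τ _ => ⌊Ψ τ⌋) ?_ ?_ ?_
  · rintro τ ⟨hτ, k, hk⟩
    rw [hk, Int.floor_intCast, Finset.coe_Icc, Set.mem_Icc, Int.ceil_le, Int.le_floor, ← hk]
    exact ⟨hanti.antitoneOn hτ ⟨hab, le_rfl⟩ hτ.2, hanti.antitoneOn ⟨le_rfl, hab⟩ hτ hτ.1⟩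
  · rintro σ τ ⟨hσ, k, hk⟩ ⟨hτ, l, hl⟩ h
    rw [hk, hl, Int.floor_intCast, Int.floor_intCast] at h
    exact hanti.injOn hσ hτ (by rw [hk, hl, h])
  · intro k hk
    rw [Finset.coe_Icc, Set.mem_Icc, Int.ceil_le, Int.le_floor] at hk
    obtain ⟨τ, hτ, h⟩ := intermediate_value_Icc' hab hc hk
    exact ⟨τ, ⟨hτ, k, h⟩, by simp [h]⟩

theorem I_pow_eq_exp (d : ℕ) :
    Complex.I ^ d = Complex.exp (Complex.I * (d * (Real.pi / 2) : ℝ)) := by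
  have h : Complex.I ^ d = Complex.exp (Real.pi / 2 * Complex.I) ^ d := by
    rw [Complex.exp_pi_div_two_mul_I]
  rw [h, ← Complex.exp_nat_mul]
  push_cast
  ring_nf

theorem tendsto_log_log_div_log :
    Tendsto (fun d : ℕ => Real.log (2 * (Real.log d + 1) + 2) / Real.log d) atTop (𝓝 0) := by
  have h1 : Tendsto (fun d : ℕ => Real.log d) atTop atTop :=
    Real.tendsto_log_atTop.comp tendsto_natCast_atTop_atTop
  have h2 : Tendsto (fun x : ℝ => (Real.log 4 + Real.log x) / x) atTop (𝓝 0) := by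
    have h3 := Real.isLittleO_log_id_atTop.tendsto_div_nhds_zero
    have h4 : Tendsto (fun x : ℝ => Real.log 4 / x) atTop (𝓝 0) :=
      tendsto_const_nhds.div_atTop tendsto_id
    simpa [add_div] using h4.add h3
  refine squeeze_zero' ?_ ?_ (h2.comp h1)
  · filter_upwards with d
    have h0 := Real.log_natCast_nonneg d
    exact div_nonneg (Real.log_nonneg (by linarith)) h0
  · filter_upwards [h1.eventually_ge_atTop 2] with d hd
    simp only [Function.comp_apply]
    rw [← Real.log_mul (by norm_num) (by linarith)]
    gcongr
    linarith

theorem eventually_log_log_le {c : ℝ} (hc : 0 < c) (A : ℝ) : ∀ᶠ d : ℕ in atTop,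
    A + Real.log (2 * (Real.log d + 1) + 2) ≤ c * Real.log d := by
  have h1 : Tendsto (fun d : ℕ => Real.log d) atTop atTop :=
    Real.tendsto_log_atTop.comp tendsto_natCast_atTop_atTop
  filter_upwards [tendsto_log_log_div_log.eventually_lt_const (by positivity : 0 < c / 2),
    h1.eventually_ge_atTop 1, h1.eventually_ge_atTop (A / (c / 2))] with d h2 h3 h4
  rw [div_lt_iff₀ (by linarith)] at h2
  rw [div_le_iff₀ (by positivity)] at h4
  linarith

/-- Up to a positive factor, the real part in the root criterion is the cosine of `dπ/2 + gammaArg +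
θ`. Dividing this phase by `π` and subtracting `1/2` moves the zeros of the cosine to the integers.
The slope bound retains half of `log d`; the other half pays for `log(2T + 2)` and for the Lipschitz
constant of `θ`. -/
theorem exists_counting_phase {η : ℝ} (hη : 0 < η) : ∀ᶠ d : ℕ in atTop, ∃ Ψ : ℝ → ℝ,
    ContinuousOn Ψ (Set.Icc (-(Real.log d + 1)) (Real.log d + 1)) ∧
    (∀ σ τ, -(Real.log d + 1) ≤ σ → σ ≤ τ → τ ≤ Real.log d + 1 →
      Real.log d / (2 * Real.pi) * (τ - σ) ≤ Ψ σ - Ψ τ) ∧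
    (∀ σ τ, |σ| ≤ Real.log d + 1 → |τ| ≤ Real.log d + 1 →
      |Ψ σ - Ψ τ - (gammaArg d σ - gammaArg d τ) / Real.pi| ≤ η) ∧
    ∀ τ : ℝ, |τ| ≤ Real.log d + 1 →
      ((crossEhrhart d).IsRoot (-1 / 2 + Complex.I * τ) ↔ ∃ k : ℤ, Ψ τ = k) := by
  filter_upwards [exists_phase hη, eventually_log_log_le (c := 1 / 2) (by norm_num) η,
    eventually_ge_atTop 1] with d ⟨θ, hθ, hθL⟩ hlog hd1
  have hp := Real.pi_gt_three
  set T := Real.log d + 1 with hT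
  have hΨ : ∀ σ τ, ((gammaArg d σ + θ σ) / Real.pi + d / 2 - 1 / 2) -
      ((gammaArg d τ + θ τ) / Real.pi + d / 2 - 1 / 2) =
      ((gammaArg d σ - gammaArg d τ) + (θ σ - θ τ)) / Real.pi := fun σ τ => by ring
  refine ⟨fun τ => (gammaArg d τ + θ τ) / Real.pi + d / 2 - 1 / 2, ?_, ?_, ?_, ?_⟩
  · have hθc : ContinuousOn θ (Set.Icc (-T) T) := by
      have : LipschitzOnWith (Real.toNNReal η) θ (Set.Icc (-T) T) := by
        refine LipschitzOnWith.of_dist_le_mul fun x hx y hy => ?_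
        rw [Real.coe_toNNReal _ hη.le, Real.dist_eq, Real.dist_eq]
        exact hθL x y (abs_le.2 hx) (abs_le.2 hy)
      exact this.continuousOn
    have := (gammaArg_spec d).1.continuousOn (s := Set.Icc (-T) T)
    fun_prop
  · intro σ τ hσ hστ hτ
    simp only [hΨ]
    have h1 := (gammaArg_sub d hσ hστ hτ).1
    have h2 := (abs_le.1 (hθL σ τ (abs_le.2 ⟨hσ, hστ.trans hτ⟩) (abs_le.2 ⟨hσ.trans hστ, hτ⟩))).1
    rw [abs_of_nonpos (by linarith : σ - τ ≤ 0)] at h2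
    have h3 : Real.log d ≤ Real.log (2 * d + 1) := by
      have : (1 : ℝ) ≤ d := by exact_mod_cast hd1
      exact Real.log_le_log (by linarith) (by linarith)
    rw [le_div_iff₀ Real.pi_pos]
    have h4 : Real.log d / (2 * Real.pi) * (τ - σ) * Real.pi = Real.log d / 2 * (τ - σ) := by
      field_simp
    rw [h4]
    nlinarith
  · intro σ τ hσ hτ
    simp only [hΨ]
    rw [add_div, add_sub_cancel_left, abs_div, abs_of_pos Real.pi_pos, div_le_iff₀ Real.pi_pos]
    have h1 := (hθ σ hσ).1
    have h2 := (hθ τ hτ).1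
    have := abs_sub (θ σ) (θ τ)
    nlinarith
  · intro τ hτ
    obtain ⟨r, hr, h⟩ := (hθ τ hτ).2
    have hre : (Complex.I ^ d * crossIntegral d (1 / 2 + Complex.I * τ)).re =
        r * Real.cos (d * (Real.pi / 2) + (gammaArg d τ + θ τ)) := by
      rw [h, I_pow_eq_exp, mul_left_comm, ← Complex.exp_add, ← mul_add, ← Complex.ofReal_add,
        mul_comm Complex.I, Complex.re_ofReal_mul, Complex.exp_ofReal_mul_I_re]
    rw [isRoot_crossEhrhart_iff, hre, mul_eq_zero, or_iff_right hr.ne', Real.cos_eq_zero_iff]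
    refine exists_congr fun k => ?_
    field_simp
    constructor <;> intro h <;> linarith

/-- A root is determined by its imaginary part because its real part is `-1/2`. -/
theorem crossRootCount_eq (d : ℕ) (a b : ℝ) : crossRootCount d a b =
    Set.ncard {τ : ℝ | τ ∈ Set.Icc a b ∧ (crossEhrhart d).IsRoot (-1 / 2 + Complex.I * τ)} := by
  have hz : ∀ z : ℂ, (crossEhrhart d).IsRoot z → (-1 / 2 + Complex.I * z.im : ℂ) = z := by
    intro z hz
    have := re_eq_of_isRoot_crossEhrhart hz
    apply Complex.ext
    · rw [this]
      simp
    · simp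
  refine Set.ncard_congr (fun z _ => z.im) ?_ ?_ ?_
  · rintro z ⟨h, him⟩
    refine ⟨him, ?_⟩
    rwa [hz z h]
  · rintro z w ⟨h, -⟩ ⟨h', -⟩ him
    rw [← hz z h, ← hz w h', him]
  · rintro τ ⟨hτ, h⟩
    exact ⟨-1 / 2 + Complex.I * τ, ⟨h, by simpa using hτ⟩, by simp⟩

/-- If `Ψ a` were within `m * s` of an integer, the slope would force `Ψ` to attain that integer
within distance `s` of `a`, and this would be a root. -/
theorem abs_sub_intCast_of_root_free {d : ℕ} {Ψ : ℝ → ℝ} {T s m a : ℝ} (hs : 0 < s)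
    (hc : ContinuousOn Ψ (Set.Icc (-T) T))
    (hslope : ∀ σ τ, -T ≤ σ → σ ≤ τ → τ ≤ T → m * (τ - σ) ≤ Ψ σ - Ψ τ)
    (hroot : ∀ τ : ℝ, |τ| ≤ T →
      ((crossEhrhart d).IsRoot (-1 / 2 + Complex.I * τ) ↔ ∃ k : ℤ, Ψ τ = k))
    (ha : -T ≤ a - s) (ha' : a + s ≤ T)
    (hfree : ∀ z : ℂ, (crossEhrhart d).IsRoot z → s < |z.im - a|) (k : ℤ) :
    m * s ≤ |Ψ a - k| := by
  by_contra! hlt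
  have h1 := hslope (a - s) a ha (by linarith) (by linarith)
  have h2 := hslope a (a + s) (by linarith) (by linarith) ha'
  have hk := abs_lt.1 hlt
  have hsub : Set.Icc (a - s) (a + s) ⊆ Set.Icc (-T) T := Set.Icc_subset_Icc ha ha'
  obtain ⟨τ, hτ, h⟩ := intermediate_value_Icc' (by linarith : a - s ≤ a + s) (hc.mono hsub)
    (show (k : ℝ) ∈ Set.Icc (Ψ (a + s)) (Ψ (a - s)) by constructor <;> linarith)
  have := hfree _ ((hroot τ (abs_le.2 (hsub hτ))).2 ⟨k, h⟩)
  simp only [Complex.add_im, Complex.mul_im, Complex.I_re, Complex.I_im, Complex.ofReal_im,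
    Complex.ofReal_re] at this
  norm_num at this
  have h3 : |τ - a| ≤ s := abs_le.2 ⟨by linarith [hτ.1], by linarith [hτ.2]⟩
  linarith

/-! ### The two counting statements -/

theorem eventually_abs_crossRootCount_sub {δ : ℝ} (hδ : 0 < δ) :
    ∀ᶠ d : ℕ in atTop, ∀ a b : ℝ, -Real.log d ≤ a → a < b → b ≤ Real.log d →
      |(crossRootCount d a b : ℝ) - (gammaArg d a - gammaArg d b) / Real.pi| < 1 + δ ∧
      ((∀ z : ℂ, (crossEhrhart d).IsRoot z → δ / Real.log d ≤ |z.im - a|) ∨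
        (∀ z : ℂ, (crossEhrhart d).IsRoot z → δ / Real.log d ≤ |z.im - b|) →
        |(crossRootCount d a b : ℝ) - (gammaArg d a - gammaArg d b) / Real.pi| < 1) := by
  have hp := Real.pi_pos
  set ρ := min δ 1 with hρ
  have hρ0 : 0 < ρ := by positivity
  have hρδ : ρ ≤ δ := min_le_left _ _
  have hρ1 : ρ ≤ 1 := min_le_right _ _
  -- The root-free condition will gain `ρ / (4π)` in the integer count; the phase error must consume
  -- only part of it, here half.
  have hη : 0 < min (δ / 2) (ρ / (8 * Real.pi)) := by positivity
  have hlogt : Tendsto (fun d : ℕ => Real.log d) atTop atTop :=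
    Real.tendsto_log_atTop.comp tendsto_natCast_atTop_atTop
  filter_upwards [exists_counting_phase hη, hlogt.eventually_ge_atTop 1] with
    d ⟨Ψ, hc, hslope, herr, hroot⟩ hlog a b ha hab hb
  set T := Real.log d + 1 with hT
  have hsub : Set.Icc a b ⊆ Set.Icc (-T) T := Set.Icc_subset_Icc (by linarith) (by linarith)
  have hanti : StrictAntiOn Ψ (Set.Icc a b) := by
    intro σ hσ τ hτ hlt
    have h1 := hslope σ τ (hsub hσ).1 hlt.le (hsub hτ).2
    have h2 : 0 < Real.log d / (2 * Real.pi) * (τ - σ) :=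
      mul_pos (by positivity) (by linarith)
    linarith
  have hcount : crossRootCount d a b = (Finset.Icc ⌈Ψ b⌉ ⌊Ψ a⌋).card := by
    rw [crossRootCount_eq, ← ncard_integer_values hab.le (hc.mono hsub) hanti]
    congr 1
    ext τ
    refine and_congr_right fun hτ => hroot τ (abs_le.2 (hsub hτ))
  have hle : Ψ b ≤ Ψ a := hanti.antitoneOn ⟨le_rfl, hab.le⟩ ⟨hab.le, le_rfl⟩ hab.le
  have he := herr a b (abs_le.2 ⟨by linarith, by linarith⟩) (abs_le.2 ⟨by linarith, by linarith⟩)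
  have he1 := he.trans (min_le_left _ _)
  have he2 := he.trans (min_le_right _ _)
  rw [hcount]
  have htri := abs_sub_le (((Finset.Icc ⌈Ψ b⌉ ⌊Ψ a⌋).card : ℝ)) (Ψ a - Ψ b)
    ((gammaArg d a - gammaArg d b) / Real.pi)
  refine ⟨?_, fun hfree => ?_⟩
  · have h0 := abs_card_Icc_ceil_floor_sub_le hle (Or.inl rfl)
    linarith
  -- The factor `2` gives the strict inequality `s < δ / log d`, and `ρ ≤ 1` gives `s ≤ 1`, so that
  -- the `s`-neighbourhood of an endpoint stays inside `[-(log d + 1), log d + 1]`.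
  · set s := ρ / (2 * Real.log d) with hs
    have hs0 : 0 < s := by positivity
    have hs1 : s ≤ 1 := by
      rw [hs, div_le_one (by positivity)]
      linarith
    have hsδ : s < δ / Real.log d := by
      rw [hs, div_lt_div_iff₀ (by positivity) (by positivity)]
      nlinarith
    have hκ : Real.log d / (2 * Real.pi) * s = ρ / (4 * Real.pi) := by
      rw [hs]
      field_simp
      ring
    have hκ0 : 0 < ρ / (4 * Real.pi) := by positivity
    have hhalf : ρ / (8 * Real.pi) < ρ / (4 * Real.pi) := by
      gcongr
      norm_num
    have h1 : (∀ k : ℤ, ρ / (4 * Real.pi) ≤ |Ψ a - k|) ∨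
        ∀ k : ℤ, ρ / (4 * Real.pi) ≤ |Ψ b - k| := by
      rw [← hκ]
      refine hfree.imp (fun h => ?_) fun h => ?_
      · exact abs_sub_intCast_of_root_free hs0 hc hslope hroot (by linarith) (by linarith)
          fun z hz => hsδ.trans_le (h z hz)
      · exact abs_sub_intCast_of_root_free hs0 hc hslope hroot (by linarith) (by linarith)
          fun z hz => hsδ.trans_le (h z hz)
    have h0 := abs_card_Icc_ceil_floor_sub_le hle (Or.inr ⟨hκ0, h1⟩)
    linarith

theorem mainTheorem3 :
    (∀ δ : ℝ, 0 < δ → ∃ D : ℕ, ∀ d : ℕ, D ≤ d → ∀ a b : ℝ,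
      -Real.log d ≤ a → a < b → b ≤ Real.log d →
        |(crossRootCount d a b : ℝ) - (gammaArg d a - gammaArg d b) / Real.pi| < 1 + δ ∧
        ((∀ z : ℂ, (crossEhrhart d).IsRoot z → δ / Real.log d ≤ |z.im - a|) ∨
          (∀ z : ℂ, (crossEhrhart d).IsRoot z → δ / Real.log d ≤ |z.im - b|) →
          |(crossRootCount d a b : ℝ) - (gammaArg d a - gammaArg d b) / Real.pi| < 1)) ∧
    (∀ a b : ℕ → ℝ,
      (∀ᶠ d : ℕ in atTop, -Real.log d ≤ a d ∧ a d < b d ∧ b d ≤ Real.log d) →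
      Tendsto (fun d : ℕ => Real.log d * (b d - a d)) atTop atTop →
      (fun d : ℕ => (crossRootCount d (a d) (b d) : ℝ)) ~[atTop]
        fun d : ℕ => Real.log d / Real.pi * (b d - a d)) := by
  refine ⟨fun δ hδ => eventually_atTop.1 (eventually_abs_crossRootCount_sub hδ), ?_⟩
  intro a b hab htend
  have hp := Real.pi_pos
  refine IsLittleO.of_bound fun c hc => ?_
  -- With `δ = 1` the counting error is below `2`, and the threshold `4π/c` makes this at most half
  -- of the allowance `c`. The other half absorbs the deviation of the slope of `gammaArg` from `log
  -- d`, where `5 = 3 + 2` comes from `log(2d + 1) + 3 ≤ log d + 5`.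
  filter_upwards [hab, eventually_abs_crossRootCount_sub one_pos,
    htend.eventually_ge_atTop (4 * Real.pi / c),
    eventually_log_log_le (c := c / 2) (by positivity) 5, eventually_ge_atTop 1] with
    d ⟨ha, hlt, hb⟩ hcount hlarge hlog hd
  have hd1 : (1 : ℝ) ≤ d := by exact_mod_cast hd
  have hlog0 := Real.log_natCast_nonneg d
  have h1 := abs_lt.1 (hcount _ _ ha hlt hb).1
  obtain ⟨h2, h3⟩ := gammaArg_sub d (T := Real.log d + 1) (by linarith) hlt.le (by linarith)
  have h4 : Real.log d ≤ Real.log (2 * d + 1) := Real.log_le_log (by linarith) (by linarith)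
  have h5 : Real.log (2 * d + 1) ≤ Real.log d + 2 := by
    have h6 : Real.log (2 * d + 1) ≤ Real.log (3 * d) :=
      Real.log_le_log (by linarith) (by linarith)
    rw [Real.log_mul (by norm_num) (by linarith)] at h6
    have := Real.log_le_sub_one_of_pos (by norm_num : (0 : ℝ) < 3)
    linarith
  have h7 : 0 ≤ Real.log (2 * (Real.log d + 1) + 2) := Real.log_nonneg (by linarith)
  set L := Real.log (2 * (Real.log d + 1) + 2) with hL
  set g := gammaArg d (a d) - gammaArg d (b d) with hg
  have hw : 0 < b d - a d := by linarith
  have h8 : |g - Real.log d * (b d - a d)| ≤ c / 2 * (Real.log d * (b d - a d)) := by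
    rw [abs_le]
    constructor <;> nlinarith
  have h9 : 2 ≤ c / 2 * (Real.log d * (b d - a d)) / Real.pi := by
    rw [le_div_iff₀ hp]
    rw [div_le_iff₀ hc] at hlarge
    linarith
  have h10 : |g / Real.pi - Real.log d / Real.pi * (b d - a d)| ≤
      c / 2 * (Real.log d * (b d - a d)) / Real.pi := by
    rw [show g / Real.pi - Real.log d / Real.pi * (b d - a d) =
      (g - Real.log d * (b d - a d)) / Real.pi by ring, abs_div, abs_of_pos hp]
    gcongr
  have h11 := abs_le.1 h10
  have h12 : 0 ≤ Real.log d / Real.pi * (b d - a d) := by positivity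
  simp only [Pi.sub_apply]
  rw [Real.norm_eq_abs, Real.norm_of_nonneg h12,
    show c * (Real.log d / Real.pi * (b d - a d)) =
      c / 2 * (Real.log d * (b d - a d)) / Real.pi +
        c / 2 * (Real.log d * (b d - a d)) / Real.pi by ring, abs_le]
  constructor <;> linarith
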